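/- Let $H$ and $L$ be complex Hilbert spaces, let $\mathcal N$ be a nest on $H$ (a totally ordered set of orthogonal projections of $H$ that contains $0$ and $I_H$ and is closed under arbitrary intersections and closed spans), let $\mathcal A=\mathrm{Alg}\,\mathcal N=\{x\in\mathbb B(H) : p^{\perp}xp=0 \text{ for all } p\in\mathcal N\}$ be its nest algebra, where $p^\perp=I-p$, and let $Y\subseteq\mathbb B(H,L)$ be a linear subspace. Call $Y$ a concrete strongly projectively right w*-rigged module over $\mathcal A$ if there is a w*-closed linear subspace $T\subseteq\mathbb B(H,L)$ with $TT^*T\subseteq T$ and $T^*T\subseteq\mathcal A$ such that the unit of the w*-closed linear span of $T^*T$ is $I_H$ and $Y$ is the w*-closed linear span of $\{ta : t\in T,\ a\in\mathcal A\}$. The following are equivalent. (i) $Y$ is a concrete strongly projectively right w*-rigged module over $\mathcal A$. (ii) There exist a Hilbert space $K$ (a closed subspace of $L$), a nest $\mathcal M$ on $K$ and a $*$-isomorphism $\theta:\mathcal N''\to\mathcal M''$ of the double commutants such that $\theta(\mathcal N)=\mathcal M$ and $$Y=\{y\in\mathbb B(H,K) : \theta(p)^{\perp}\,y\,p=0\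 \text{ for all } p\in\mathcal N\},$$ where $\mathbb B(H,K)$ is regarded as the subspace of $\mathbb B(H,L)$ of the operators with range in $K$. -/

import Mathlib

open scoped InnerProductSpace Topology

noncomputable section

namespace NestModule

universe u v

section WStar

variable (H : Type u) (K : Type v) [NormedAddCommGroup H] [InnerProductSpace ℂ H]
  [NormedAddCommGroup K] [InnerProductSpace ℂ K]

/-- The w*-topology (ultraweak topology) of `B(H, K)`, that is, the weak topology given by the
functionals `x ↦ ∑ₙ ⟪ηₙ, x ξₙ⟫` with `(ξₙ) ∈ ℓ²(H)` and `(ηₙ) ∈ ℓ²(K)` (the predual of `B(H, K)`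
is the space of trace class operators from `K` to `H`). -/
@[reducible]
def wstarTopology : TopologicalSpace (H →L[ℂ] K) :=
  ⨅ (ξ : lp (fun _ : ℕ => H) 2) (η : lp (fun _ : ℕ => K) 2),
    TopologicalSpace.induced (fun x : H →L[ℂ] K => ∑' n, ⟪η n, x (ξ n)⟫_ℂ) inferInstance

end WStar

section Basic

variable {H : Type u} {K : Type v} [NormedAddCommGroup H] [InnerProductSpace ℂ H]
  [NormedAddCommGroup K] [InnerProductSpace ℂ K]

/-- `S ⊆ B(H, K)` is closed in the w*-topology. -/
def IsWStarClosed (S : Set (H →L[ℂ] K)) : Prop :=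
  IsClosed[wstarTopology H K] S

/-- The w*-closure of the linear span of `S ⊆ B(H, K)`. -/
def wstarSpan (S : Set (H →L[ℂ] K)) : Set (H →L[ℂ] K) :=
  closure[wstarTopology H K] (Submodule.span ℂ S : Set (H →L[ℂ] K))

/-- The matrix coefficients `x ↦ ⟪k, x h⟫` are w*-continuous. -/
theorem continuous_wstar_inner (h : H) (k : K) :
    Continuous[wstarTopology H K, inferInstance] (fun x : H →L[ℂ] K => ⟪k, x h⟫_ℂ) := by
  have key : (fun x : H →L[ℂ] K => ⟪k, x h⟫_ℂ) = fun x : H →L[ℂ] K =>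
      ∑' n, ⟪(lp.single (E := fun _ : ℕ => K) 2 0 k) n,
        x ((lp.single (E := fun _ : ℕ => H) 2 0 h) n)⟫_ℂ := by
    funext x
    rw [tsum_eq_single 0]
    · simp
    · intro n hn
      simp [hn]
  rw [key]
  exact continuous_iff_le_induced.2 (iInf_le_of_le _ (iInf_le _ _))

end Basic

section Algebras

variable (H : Type u) [NormedAddCommGroup H] [InnerProductSpace ℂ H]

/-- A unital dual operator algebra acting on `H`: a w*-closed subalgebra of `B(H)` with
`1 ∈ A`. -/
structure DualOperatorAlgebra extends Subalgebra ℂ (H →L[ℂ] H) where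
  wstarClosed : IsWStarClosed carrier

variable [CompleteSpace H]

/-- A nest on `H`: a totally ordered set of orthogonal projections of `H` that contains `0` and `1`
and is closed under arbitrary intersections and closed spans. -/
structure Nest where
  carrier : Set (H →L[ℂ] H)
  isStarProjection : ∀ p ∈ carrier, IsStarProjection p
  total : ∀ p ∈ carrier, ∀ q ∈ carrier, p.range ≤ q.range ∨ q.range ≤ p.range
  zero_mem : 0 ∈ carrier
  one_mem : 1 ∈ carrier
  inter_mem : ∀ S ⊆ carrier, ∃ r ∈ carrier, r.range = ⨅ p ∈ S, p.range
  closedSpan_mem : ∀ S ⊆ carrier, ∃ r ∈ carrier,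
    r.range = (⨆ p ∈ S, p.range).topologicalClosure

variable {H}

/-- The nest algebra `Alg N = {x ∈ B(H) : p^⊥ x p = 0 for all p ∈ N}`. -/
def Nest.alg (N : Nest H) : DualOperatorAlgebra H where
  carrier := {x | ∀ p ∈ N.carrier, (1 - p) * x * p = 0}
  mul_mem' := by
    intro x y hx hy p hp
    have h1 : y * p = p * y * p := by
      have := hy p hp
      rw [sub_mul, sub_mul, one_mul, sub_eq_zero] at this
      exact this
    calc (1 - p) * (x * y) * p = (1 - p) * x * (y * p) := by simp only [mul_assoc]
      _ = (1 - p) * x * (p * y * p) := congrArg _ h1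
      _ = (1 - p) * x * p * (y * p) := by simp only [mul_assoc]
      _ = 0 := by rw [hx p hp, zero_mul]
  add_mem' := by
    intro x y hx hy p hp
    rw [mul_add, add_mul, hx p hp, hy p hp, add_zero]
  algebraMap_mem' := by
    intro c p hp
    have hpp : p * p = p := (N.isStarProjection p hp).isIdempotentElem
    rw [Algebra.algebraMap_eq_smul_one]
    simp [sub_mul, hpp]
  wstarClosed := by
    let _ := wstarTopology H H
    have : {x : H →L[ℂ] H | ∀ p ∈ N.carrier, (1 - p) * x * p = 0} =
        ⋂ p ∈ N.carrier, ⋂ (h : H), ⋂ (k : H),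
          (fun x : H →L[ℂ] H => ⟪ContinuousLinearMap.adjoint (1 - p) k, x (p h)⟫_ℂ) ⁻¹' {0} := by
      ext x
      simp only [Set.mem_ofPred_eq, Set.mem_iInter, Set.mem_preimage, Set.mem_singleton_iff,
        ContinuousLinearMap.adjoint_inner_left]
      refine forall₂_congr fun p _ => ⟨fun h a b => ?_, fun h => ?_⟩
      · have := congrArg (fun z : H →L[ℂ] H => z a) h
        simp only [mul_apply_eq_comp, zero_apply] at this
        rw [this, inner_zero_right]
      · ext a
        exact inner_self_eq_zero.1 (h a _)
    change IsClosed {x : H →L[ℂ] H | ∀ p ∈ N.carrier, (1 - p) * x * p = 0}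
    rw [this]
    exact isClosed_biInter fun p _ => isClosed_iInter fun h => isClosed_iInter fun k =>
      isClosed_singleton.preimage (continuous_wstar_inner _ _)

/-- The double commutant `N''` of a nest, as a *-subalgebra of `B(H)`. -/
def Nest.doubleCommutant (N : Nest H) : StarSubalgebra ℂ (H →L[ℂ] H) :=
  StarSubalgebra.centralizer ℂ (StarSubalgebra.centralizer ℂ N.carrier : Set (H →L[ℂ] H))

theorem Nest.coe_doubleCommutant (N : Nest H) :
    (N.doubleCommutant : Set (H →L[ℂ] H)) = Set.centralizer (Set.centralizer N.carrier) := by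
  have hN : star N.carrier = N.carrier := by
    ext p
    constructor
    · intro h
      have := (N.isStarProjection _ h).isSelfAdjoint.star_eq
      rw [star_star] at this
      rw [this]
      exact h
    · intro h
      change star p ∈ N.carrier
      rwa [(N.isStarProjection _ h).isSelfAdjoint.star_eq]
  have h1 : (StarSubalgebra.centralizer ℂ N.carrier : Set (H →L[ℂ] H)) =
      Set.centralizer N.carrier := by
    rw [StarSubalgebra.coe_centralizer, hN, Set.union_self]
  rw [Nest.doubleCommutant, StarSubalgebra.coe_centralizer, StarMemClass.star_coe_eq,
    Set.union_self, h1]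

end Algebras

section Modules

variable {H : Type u} {K : Type v} [NormedAddCommGroup H] [InnerProductSpace ℂ H]
  [CompleteSpace H] [NormedAddCommGroup K] [InnerProductSpace ℂ K] [CompleteSpace K]

/-- A w*-closed TRO (ternary ring of operators): a w*-closed linear subspace `M` of `B(H, K)` with
`M M* M ⊆ M`. -/
structure IsWStarClosedTRO (M : Submodule ℂ (H →L[ℂ] K)) : Prop where
  wstarClosed : IsWStarClosed (M : Set (H →L[ℂ] K))
  ternary : ∀ x ∈ M, ∀ y ∈ M, ∀ z ∈ M, x ∘L ContinuousLinearMap.adjoint y ∘L z ∈ M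

/-- `Y ⊆ B(H, K)` is a concrete strongly projectively right w*-rigged module over `A ⊆ B(H)`: there
is a w*-closed TRO `M ⊆ B(H, K)` with `M* M ⊆ A` such that the unit of the w*-closed linear span of
`M* M` is the unit `1` of `A`, and `Y` is the w*-closed linear span of `M A`. -/
def IsConcreteStronglyProjective (A : DualOperatorAlgebra H) (Y : Submodule ℂ (H →L[ℂ] K)) :
    Prop :=
  ∃ M : Submodule ℂ (H →L[ℂ] K), IsWStarClosedTRO M ∧
    (∀ x ∈ M, ∀ y ∈ M, ContinuousLinearMap.adjoint x ∘L y ∈ A.toSubalgebra) ∧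
    (1 : H →L[ℂ] H) ∈
      wstarSpan {z : H →L[ℂ] H | ∃ x ∈ M, ∃ y ∈ M, z = ContinuousLinearMap.adjoint x ∘L y} ∧
    (Y : Set (H →L[ℂ] K)) =
      wstarSpan {z : H →L[ℂ] K | ∃ m ∈ M, ∃ a ∈ A.toSubalgebra, z = m ∘L a}

/-- For a *-isomorphism `θ : N'' → M''`, the space
`{y ∈ B(H, K) : θ(p)^⊥ y p = 0 for all p ∈ N}`. -/
def opSpace {N : Nest H} {M : Nest K} (θ : N.doubleCommutant ≃⋆ₐ[ℂ] M.doubleCommutant) :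
    Set (H →L[ℂ] K) :=
  {y | ∀ p : N.doubleCommutant, (p : H →L[ℂ] H) ∈ N.carrier →
    (1 - (θ p : K →L[ℂ] K)) ∘L y ∘L (p : H →L[ℂ] H) = 0}

end Modules

end NestModule

end

/-!
Both directions use the same formula for a module generated by a ternary ring `T` (a TRO). Suppose
`t p = Θ(p) t` for `t ∈ T` and the projections `p` of the nest, with `Θ(p)` self-adjoint. Then
`T A` lies in `{y : Θ(p)^⊥ y p = 0}`. Conversely, for such a `y` every `s* y` with `s ∈ T` belongs to
`A`, so that `t s* y ∈ T A`, and the span of `T T*` approximates the unit, so `y` is in the w*-closed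
span of `T A` (`wstarSpan_mul_alg`). The approximation is von Neumann's density argument on
`ℓ²`-sums (`mem_wstarClosure_mul`), for `*`-algebras that may act degenerately.

From the module to the nest: `T* T` lies in the diagonal of `Alg N`, that is, in `N'`. Let `K` be
the closed span of the ranges of the operators in `T`. Each `x` commuting with `T* T` has a unique
partner `z` on `K` with `z t = t x` (`exists_comp_eq`), and this correspondence identifies the
commutants of `T* T` and of `T T*`. It carries the nest `N` to a nest on `K` (`Nest.transport`), and
`N''` onto the double commutant of that nest, because `t* w s ∈ N'` whenever `w` commutes with the
transported nest (`Nest.exists_starAlgEquiv`).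

From the nest to the module: `T` consists of the operators with range in `K` that intertwine `N''`
and `θ(N'')`. What has to be shown is that there are enough of them: none but the zero vector is
killed by all the intertwiners of a `*`-isomorphism `θ : 𝒜 → ℬ` of commutative von Neumann algebras
(`eq_zero_of_intertwiners_eq_zero`); applied to `θ` and `θ⁻¹` this gives nondegeneracy on both sides.
If all intertwiners kill `h` then, for each `k`, the vector `(h, 0)` is in the closure of
`{(x h, θ(x) k)}`. Cutting by spectral projections one finds projections `p n ∈ 𝒜` with
`p n h → h` and `θ(p n) k → 0`, both rapidly. Their lower bounds `q m = ⋀_{n ≥ m} p n` satisfy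
`θ(q m) k = 0` and `q m h → h`. So the preimage of the support projection of `k` kills every `q m`,
hence `h`, hence the support projection of `h`. As `k` is arbitrary, `θ` kills the support projection
of `h`, and `h = 0`. Normality of `θ` is never needed as a separate fact: the support projections
take its place.
-/

noncomputable section

namespace NestModule

open ContinuousLinearMap (adjoint)

/-! ### Invariant subspaces and the density theorem -/

section Density

variable {E : Type*} [NormedAddCommGroup E] [InnerProductSpace ℂ E]
  {F : Type*} [NormedAddCommGroup F] [InnerProductSpace ℂ F]

/-- The projection onto a subspace reducing `x` commutes with `x`. -/
theorem commute_starProjection [CompleteSpace E] {U : Submodule ℂ E}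
    [U.HasOrthogonalProjection] {x : E →L[ℂ] E}
    (h : ∀ u ∈ U, x u ∈ U) (h' : ∀ u ∈ U, adjoint x u ∈ U) :
    Commute x U.starProjection := by
  ext v
  have key : U.starProjection (x v) = x (U.starProjection v) := by
    refine Submodule.eq_starProjection_of_mem_of_inner_eq_zero
      (h _ (U.starProjection_apply_mem v)) fun w hw => ?_
    rw [← map_sub, ← ContinuousLinearMap.adjoint_inner_right]
    exact U.starProjection_inner_eq_zero v _ (h' w hw)
  exact key.symm

/-- The diagonal action `x ⊕ x ⊕ ⋯` of an operator `x` on `ℓ²(ι, F)`. -/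
def ampliation (ι : Type*) (x : F →L[ℂ] F) :
    lp (fun _ : ι => F) 2 →L[ℂ] lp (fun _ : ι => F) 2 :=
  lp.mapCLM 2 (fun _ => x) (norm_nonneg x) fun _ => le_rfl

@[simp]
theorem ampliation_apply (ι : Type*) (x : F →L[ℂ] F) (ζ : lp (fun _ : ι => F) 2) (i : ι) :
    ampliation ι x ζ i = x (ζ i) := rfl

variable [CompleteSpace F]

theorem adjoint_ampliation (ι : Type*) (x : F →L[ℂ] F) :
    adjoint (ampliation ι x) = ampliation ι (adjoint x) := by
  symm
  rw [ContinuousLinearMap.eq_adjoint_iff]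
  intro ζ η
  simp only [lp.inner_eq_tsum, ampliation_apply, ContinuousLinearMap.adjoint_inner_left]

variable {D : Submodule ℂ (F →L[ℂ] F)}

/-- A vector `ζ ∈ ℓ²(ι, F)` whose entries are orthogonal to the vectors killed by the `*`-algebra
`D` is a limit of vectors `dζ` with `d ∈ D`. -/
theorem mem_closure_ampliation (hmul : ∀ c ∈ D, ∀ d ∈ D, c * d ∈ D)
    (hadj : ∀ d ∈ D, adjoint d ∈ D) {ι : Type*} (ζ : lp (fun _ : ι => F) 2)
    (hζ : ∀ v : F, (∀ d ∈ D, d v = 0) → ∀ i, ⟪v, ζ i⟫_ℂ = 0) :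
    ζ ∈ closure {z | ∃ d ∈ D, z = ampliation ι d ζ} := by
  let U₀ : Submodule ℂ (lp (fun _ : ι => F) 2) :=
    { carrier := {z | ∃ d ∈ D, z = ampliation ι d ζ}
      add_mem' := by
        rintro _ _ ⟨c, hc, rfl⟩ ⟨d, hd, rfl⟩
        exact ⟨c + d, D.add_mem hc hd, by ext i; simp⟩
      zero_mem' := ⟨0, D.zero_mem, by ext i; simp⟩
      smul_mem' := by
        rintro a _ ⟨d, hd, rfl⟩
        exact ⟨a • d, D.smul_mem a hd, by ext i; simp⟩ }
  let U := U₀.topologicalClosure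
  have hinv : ∀ d ∈ D, ∀ u ∈ U, ampliation ι d u ∈ U := by
    intro d hd u hu
    refine map_mem_closure (ampliation ι d).continuous hu ?_
    rintro _ ⟨c, hc, rfl⟩
    exact ⟨d * c, hmul d hd c hc, by ext i; simp⟩
  have : CompleteSpace U := U₀.isClosed_topologicalClosure.completeSpace_coe
  have hcomm : ∀ d ∈ D, Commute (ampliation ι d) U.starProjection := fun d hd =>
    commute_starProjection (hinv d hd) (by
      rw [adjoint_ampliation]; exact hinv _ (hadj d hd))
  set v := ζ - U.starProjection ζ with hv
  have hdv : ∀ d ∈ D, ampliation ι d v = 0 := by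
    intro d hd
    have h1 : ampliation ι d (U.starProjection ζ) = U.starProjection (ampliation ι d ζ) :=
      congrArg (fun z => z ζ) (hcomm d hd).eq
    rw [hv, map_sub, h1, Submodule.starProjection_eq_self_iff.2, sub_self]
    exact U₀.le_topologicalClosure ⟨d, hd, rfl⟩
  have hvζ : ⟪v, ζ⟫_ℂ = 0 := by
    rw [lp.inner_eq_tsum]
    refine (tsum_congr fun i => ?_).trans tsum_zero
    refine hζ _ (fun d hd => ?_) i
    rw [← ampliation_apply, hdv d hd]
    rfl
  have hv0 : v = 0 := by
    rw [← inner_self_eq_zero (𝕜 := ℂ)]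
    conv_lhs => enter [3]; rw [hv]
    rw [inner_sub_right, hvζ, U.starProjection_inner_eq_zero ζ _ (U.starProjection_apply_mem ζ),
      sub_zero]
  have : ζ ∈ U := Submodule.starProjection_eq_self_iff.1 (sub_eq_zero.1 hv0).symm
  exact this

/-- The `*`-algebra `D` approximates its unit simultaneously on finitely many square summable
sequences. -/
theorem exists_forall_norm_sub_lt (hmul : ∀ c ∈ D, ∀ d ∈ D, c * d ∈ D)
    (hadj : ∀ d ∈ D, adjoint d ∈ D) (I : Finset (lp (fun _ : ℕ => F) 2))
    (hI : ∀ v : F, (∀ d ∈ D, d v = 0) → ∀ ξ ∈ I, ∀ n, ⟪v, ξ n⟫_ℂ = 0) {ε : ℝ} (hε : 0 < ε) :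
    ∃ d ∈ D, ∀ ξ ∈ I, ‖ampliation ℕ d ξ - ξ‖ < ε := by
  have htwo : (0 : ℝ) < (2 : ENNReal).toReal := by norm_num
  have hmem : Memℓp (fun p : I × ℕ => (p.1 : lp (fun _ : ℕ => F) 2) p.2) 2 := by
    rw [memℓp_gen_iff htwo, summable_prod_of_nonneg fun p => by positivity]
    exact ⟨fun ξ => (memℓp_gen_iff htwo).1 (lp.memℓp ξ.1), Summable.of_finite⟩
  let ζ : lp (fun _ : I × ℕ => F) 2 := ⟨_, hmem⟩
  obtain ⟨_, ⟨d, hd, rfl⟩, hdist⟩ := Metric.mem_closure_iff.1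
    (mem_closure_ampliation hmul hadj ζ fun v hv i => hI v hv _ i.1.2 _) ε hε
  refine ⟨d, hd, fun ξ hξ => lt_of_le_of_lt ?_ hdist⟩
  rw [dist_comm, dist_eq_norm]
  have h1 := lp.hasSum_norm htwo (ampliation ℕ d ξ - ξ)
  have h2 := lp.hasSum_norm htwo (ampliation (I × ℕ) d ζ - ζ)
  refine (Real.rpow_le_rpow_iff (norm_nonneg _) (norm_nonneg _) htwo).1 ?_
  rw [← h1.tsum_eq, ← h2.tsum_eq]
  refine h1.summable.tsum_le_tsum_of_inj (fun n : ℕ => ((⟨ξ, hξ⟩ : I), n))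
    (fun a b hab => (Prod.ext_iff.1 hab).2) (fun _ _ => by positivity) (fun n => le_rfl) h2.summable

/-- Density theorem for a `*`-algebra `D` that may act degenerately: an operator `y` whose range is
orthogonal to the vectors killed by `D` lies in the w*-closure of `Dy`. -/
theorem mem_wstarClosure_mul (hmul : ∀ c ∈ D, ∀ d ∈ D, c * d ∈ D)
    (hadj : ∀ d ∈ D, adjoint d ∈ D) (y : E →L[ℂ] F)
    (hy : ∀ v : F, (∀ d ∈ D, d v = 0) → ∀ h, ⟪v, y h⟫_ℂ = 0) :
    y ∈ closure[wstarTopology E F] {z | ∃ d ∈ D, z = d ∘L y} := by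
  classical
  let yamp : lp (fun _ : ℕ => E) 2 →L[ℂ] lp (fun _ : ℕ => F) 2 :=
    lp.mapCLM 2 (fun _ => y) (norm_nonneg y) fun _ => le_rfl
  have hex : ∀ i : Finset (lp (fun _ : ℕ => E) 2) × ℕ, ∃ d ∈ D, ∀ ξ ∈ i.1,
      ‖ampliation ℕ d (yamp ξ) - yamp ξ‖ < 1 / ((i.2 : ℝ) + 1) := by
    intro i
    obtain ⟨d, hd, h⟩ := exists_forall_norm_sub_lt hmul hadj (i.1.image yamp)
      (by
        intro v hv ξ hξ n
        obtain ⟨ξ', -, rfl⟩ := Finset.mem_image.1 hξ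
        exact hy v hv _) (Nat.one_div_pos_of_nat (n := i.2) (α := ℝ))
    exact ⟨d, hd, fun ξ hξ => h _ (Finset.mem_image_of_mem _ hξ)⟩
  choose d hd hlt using hex
  let _ := wstarTopology E F
  refine mem_closure_of_tendsto (f := fun i => d i ∘L y) (b := Filter.atTop) ?_
    (Filter.Eventually.of_forall fun i => ⟨d i, hd i, rfl⟩)
  simp only [nhds_iInf, Filter.tendsto_iInf, nhds_induced, Filter.tendsto_comap_iff]
  intro ξ η
  rw [tendsto_iff_dist_tendsto_zero]
  have hlim : Filter.Tendsto
      (fun i : Finset (lp (fun _ : ℕ => E) 2) × ℕ => ‖η‖ * (1 / ((i.2 : ℝ) + 1)))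
      Filter.atTop (𝓝 0) := by
    have := (tendsto_one_div_add_atTop_nhds_zero_nat (𝕜 := ℝ)).const_mul ‖η‖
    rw [mul_zero] at this
    rw [← Filter.prod_atTop_atTop_eq]
    exact this.comp Filter.tendsto_snd
  refine squeeze_zero' (Filter.Eventually.of_forall fun _ => dist_nonneg) ?_ hlim
  filter_upwards [Filter.eventually_ge_atTop (({ξ}, 0) : Finset (lp (fun _ : ℕ => E) 2) × ℕ)]
    with i hi
  have hξ : ξ ∈ i.1 := hi.1 (Finset.mem_singleton_self ξ)
  rw [dist_eq_norm]
  have : (∑' n, ⟪η n, (d i ∘L y) (ξ n)⟫_ℂ) - ∑' n, ⟪η n, y (ξ n)⟫_ℂ =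
      ⟪η, ampliation ℕ (d i) (yamp ξ) - yamp ξ⟫_ℂ := by
    rw [inner_sub_right, lp.inner_eq_tsum, lp.inner_eq_tsum]
    rfl
  refine (congrArg norm this).trans_le ((norm_inner_le_norm _ _).trans ?_)
  exact mul_le_mul_of_nonneg_left (hlt i ξ hξ).le (norm_nonneg _)

end Density

/-! ### Ternary rings of operators and the modules they generate -/

section Ternary

variable {E : Type*} [NormedAddCommGroup E] [InnerProductSpace ℂ E]
  {F : Type*} [NormedAddCommGroup F] [InnerProductSpace ℂ F]

theorem isWStarClosed_forall_inner_eq {ι : Type*} (h h' : ι → E) (k k' : ι → F) :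
    IsWStarClosed {x : E →L[ℂ] F | ∀ i, ⟪k i, x (h i)⟫_ℂ = ⟪k' i, x (h' i)⟫_ℂ} := by
  let _ := wstarTopology E F
  change IsClosed {x : E →L[ℂ] F | ∀ i, ⟪k i, x (h i)⟫_ℂ = ⟪k' i, x (h' i)⟫_ℂ}
  rw [Set.ofPred_forall]
  exact isClosed_iInter fun i =>
    isClosed_eq (continuous_wstar_inner _ _) (continuous_wstar_inner _ _)

theorem wstarSpan_subset {S : Set (E →L[ℂ] F)} {C : Submodule ℂ (E →L[ℂ] F)}
    (hC : IsWStarClosed (C : Set (E →L[ℂ] F))) (hS : S ⊆ C) : wstarSpan S ⊆ C := by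
  let _ := wstarTopology E F
  exact closure_minimal (Submodule.span_le.2 hS) hC

variable [CompleteSpace E] [CompleteSpace F] {T : Submodule ℂ (E →L[ℂ] F)}

/-- The linear span of `T* T`. -/
def adjointMulSpan (T : Submodule ℂ (E →L[ℂ] F)) : Submodule ℂ (E →L[ℂ] E) :=
  Submodule.span ℂ {z | ∃ x ∈ T, ∃ y ∈ T, z = adjoint x ∘L y}

/-- The space `T* = {t* : t ∈ T}` of adjoints of a space of operators. -/
def adjointSpace (T : Submodule ℂ (E →L[ℂ] F)) : Submodule ℂ (F →L[ℂ] E) where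
  carrier := {s | adjoint s ∈ T}
  add_mem' hs ht := by
    simp only [Set.mem_ofPred_eq, map_add] at *
    exact T.add_mem hs ht
  zero_mem' := by simp
  smul_mem' c s hs := by
    simp only [Set.mem_ofPred_eq, map_smulₛₗ] at *
    exact T.smul_mem _ hs

@[simp]
theorem mem_adjointSpace {s : F →L[ℂ] E} : s ∈ adjointSpace T ↔ adjoint s ∈ T := Iff.rfl

theorem adjoint_mem_adjointMulSpan {d : E →L[ℂ] E} (hd : d ∈ adjointMulSpan T) :
    adjoint d ∈ adjointMulSpan T := by
  induction hd using Submodule.span_induction with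
  | mem d hd =>
    obtain ⟨x, hx, y, hy, rfl⟩ := hd
    refine Submodule.subset_span ⟨y, hy, x, hx, ?_⟩
    rw [ContinuousLinearMap.adjoint_comp, ContinuousLinearMap.adjoint_adjoint]
  | zero => simp
  | add c d _ _ hc hd => rw [map_add]; exact add_mem hc hd
  | smul a d _ hd => rw [map_smulₛₗ]; exact Submodule.smul_mem _ _ hd

theorem mul_mem_adjointMulSpan (hT : ∀ x ∈ T, ∀ y ∈ T, ∀ z ∈ T, x ∘L adjoint y ∘L z ∈ T)
    {c d : E →L[ℂ] E} (hc : c ∈ adjointMulSpan T) (hd : d ∈ adjointMulSpan T) :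
    c * d ∈ adjointMulSpan T := by
  induction hc using Submodule.span_induction with
  | mem c hc =>
    obtain ⟨x, hx, y, hy, rfl⟩ := hc
    induction hd using Submodule.span_induction with
    | mem d hd =>
      obtain ⟨x', hx', y', hy', rfl⟩ := hd
      exact Submodule.subset_span ⟨x, hx, _, hT y hy x' hx' y' hy', rfl⟩
    | zero => rw [mul_zero]; exact zero_mem _
    | add a b _ _ ha hb => rw [mul_add]; exact add_mem ha hb
    | smul a d _ hd => rw [mul_smul_comm]; exact Submodule.smul_mem _ _ hd
  | zero => rw [zero_mul]; exact zero_mem _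
  | add a b _ _ ha hb => rw [add_mul]; exact add_mem ha hb
  | smul a d _ hd => rw [smul_mul_assoc]; exact Submodule.smul_mem _ _ hd

theorem eq_zero_of_adjoint_comp_apply {t : E →L[ℂ] F} {v : E} (h : (adjoint t ∘L t) v = 0) :
    t v = 0 := by
  rw [← inner_self_eq_zero (𝕜 := ℂ), ← ContinuousLinearMap.adjoint_inner_right]
  have : adjoint t (t v) = 0 := h
  rw [this, inner_zero_right]

/-- The operators `y` whose range is orthogonal to the vectors killed by the ternary ring `T` are
w*-limits of operators `dy` with `d` in the span of `T* T`. -/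
theorem mem_wstarClosure_adjointMulSpan
    (hT : ∀ x ∈ T, ∀ y ∈ T, ∀ z ∈ T, x ∘L adjoint y ∘L z ∈ T)
    {G : Type*} [NormedAddCommGroup G] [InnerProductSpace ℂ G] (y : G →L[ℂ] E)
    (hy : ∀ v : E, (∀ t ∈ T, t v = 0) → ∀ g, ⟪v, y g⟫_ℂ = 0) :
    y ∈ closure[wstarTopology G E] {z | ∃ d ∈ adjointMulSpan T, z = d ∘L y} :=
  mem_wstarClosure_mul (fun _ hc _ hd => mul_mem_adjointMulSpan hT hc hd)
    (fun _ hd => adjoint_mem_adjointMulSpan hd) y fun v hv => hy v fun t ht =>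
      eq_zero_of_adjoint_comp_apply (hv _ (Submodule.subset_span ⟨t, ht, t, ht, rfl⟩))

theorem one_mem_wstarSpan (hT : ∀ x ∈ T, ∀ y ∈ T, ∀ z ∈ T, x ∘L adjoint y ∘L z ∈ T)
    (h0 : ∀ h : E, (∀ t ∈ T, t h = 0) → h = 0) :
    (1 : E →L[ℂ] E) ∈ wstarSpan {z | ∃ x ∈ T, ∃ y ∈ T, z = adjoint x ∘L y} := by
  let _ := wstarTopology E E
  refine closure_mono ?_ (mem_wstarClosure_adjointMulSpan hT 1 fun v hv g => ?_)
  · rintro _ ⟨d, hd, rfl⟩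
    exact hd
  · rw [h0 v hv, inner_zero_left]

/-- If the unit is in the w*-closed span of `T* T` then `T` acts nondegenerately. -/
theorem eq_zero_of_one_mem_wstarSpan
    (h1 : (1 : E →L[ℂ] E) ∈ wstarSpan {z | ∃ x ∈ T, ∃ y ∈ T, z = adjoint x ∘L y})
    {h : E} (hh : ∀ t ∈ T, t h = 0) : h = 0 := by
  let C : Submodule ℂ (E →L[ℂ] E) :=
    { carrier := {x | ⟪h, x h⟫_ℂ = 0}
      add_mem' := fun {x y} hx hy => by
        have hx' : ⟪h, x h⟫_ℂ = 0 := hx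
        have hy' : ⟪h, y h⟫_ℂ = 0 := hy
        simp [hx', hy']
      zero_mem' := by simp
      smul_mem' := fun c x hx => by
        have hx' : ⟪h, x h⟫_ℂ = 0 := hx
        simp [hx'] }
  have hC : IsWStarClosed (C : Set (E →L[ℂ] E)) := by
    have := isWStarClosed_forall_inner_eq (fun _ : Unit => h) (fun _ => h) (fun _ => h)
      (fun _ => (0 : E))
    change IsWStarClosed {x : E →L[ℂ] E | ⟪h, x h⟫_ℂ = 0}
    simpa only [inner_zero_left, map_zero, inner_zero_right, forall_const] using this
  have : (1 : E →L[ℂ] E) ∈ C := wstarSpan_subset hC (by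
    rintro _ ⟨x, hx, y, hy, rfl⟩
    change ⟪h, adjoint x (y h)⟫_ℂ = 0
    rw [hh y hy, map_zero, inner_zero_right]) h1
  exact inner_self_eq_zero.1 this

theorem Nest.mem_doubleCommutant {N : Nest E} {x : E →L[ℂ] E} :
    x ∈ N.doubleCommutant ↔ x ∈ Set.centralizer (Set.centralizer N.carrier) := by
  rw [← N.coe_doubleCommutant, SetLike.mem_coe]

theorem Nest.carrier_subset_doubleCommutant (N : Nest E) {p : E →L[ℂ] E} (hp : p ∈ N.carrier) :
    p ∈ N.doubleCommutant :=
  Nest.mem_doubleCommutant.2 (Set.subset_centralizer_centralizer hp)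

theorem Nest.mem_alg_of_commute {N : Nest E} {x : E →L[ℂ] E}
    (hx : ∀ p ∈ N.carrier, Commute p x) : x ∈ N.alg.toSubalgebra := by
  intro p hp
  rw [mul_assoc, ← (hx p hp).eq, ← mul_assoc, sub_mul, one_mul,
    (N.isStarProjection p hp).isIdempotentElem.eq, sub_self, zero_mul]

/-- If `tp = qt` and `sp = qs` with `p` and `q` self-adjoint then `p` commutes with `t* s`. -/
theorem commute_adjoint_comp {p : E →L[ℂ] E} {q : F →L[ℂ] F} (hp : IsSelfAdjoint p)
    (hq : IsSelfAdjoint q) {s t : E →L[ℂ] F} (hs : s ∘L p = q ∘L s) (ht : t ∘L p = q ∘L t) :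
    Commute p (adjoint t ∘L s) := by
  have ht' : p ∘L adjoint t = adjoint t ∘L q := by
    have := congrArg adjoint ht
    rwa [ContinuousLinearMap.adjoint_comp, ContinuousLinearMap.adjoint_comp, hp.adjoint_eq,
      hq.adjoint_eq] at this
  change p ∘L (adjoint t ∘L s) = (adjoint t ∘L s) ∘L p
  rw [ContinuousLinearMap.comp_assoc, hs, ← ContinuousLinearMap.comp_assoc, ht',
    ContinuousLinearMap.comp_assoc]

/-- Let `T` be a ternary ring of operators with `t p = Θ(p) t`, whose adjoints kill only vectors
orthogonal to the ranges of the `y` with `Θ(p)^⊥ y p = 0`. Then these `y` form the module generated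
by `T` over the nest algebra: `t* y ∈ Alg N` for `t ∈ T`, so that `t s* y` lies in this module, and
the span of `T T*` approximates the unit. -/
theorem wstarSpan_mul_alg {N : Nest E}
    (hT : ∀ x ∈ T, ∀ y ∈ T, ∀ z ∈ T, x ∘L adjoint y ∘L z ∈ T)
    {Θ : N.doubleCommutant → (F →L[ℂ] F)}
    (hΘ : ∀ p : N.doubleCommutant, (p : E →L[ℂ] E) ∈ N.carrier → IsSelfAdjoint (Θ p))
    (hTΘ : ∀ p : N.doubleCommutant, (p : E →L[ℂ] E) ∈ N.carrier →
      ∀ t ∈ T, t ∘L (p : E →L[ℂ] E) = Θ p ∘L t)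
    (hY : ∀ y : E →L[ℂ] F, (∀ p : N.doubleCommutant, (p : E →L[ℂ] E) ∈ N.carrier →
      y ∘L (p : E →L[ℂ] E) = Θ p ∘L y ∘L (p : E →L[ℂ] E)) →
        ∀ v : F, (∀ t ∈ T, adjoint t v = 0) → ∀ h, ⟪v, y h⟫_ℂ = 0) :
    wstarSpan {z : E →L[ℂ] F | ∃ m ∈ T, ∃ a ∈ N.alg.toSubalgebra, z = m ∘L a} =
      {y | ∀ p : N.doubleCommutant, (p : E →L[ℂ] E) ∈ N.carrier →
        y ∘L (p : E →L[ℂ] E) = Θ p ∘L y ∘L (p : E →L[ℂ] E)} := by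
  let C : Submodule ℂ (E →L[ℂ] F) :=
    { carrier := {y | ∀ p : N.doubleCommutant, (p : E →L[ℂ] E) ∈ N.carrier →
        y ∘L (p : E →L[ℂ] E) = Θ p ∘L y ∘L (p : E →L[ℂ] E)}
      add_mem' := fun {x y} hx hy p hp => by
        rw [ContinuousLinearMap.add_comp, ContinuousLinearMap.comp_add, ← hx p hp, ← hy p hp]
      zero_mem' := fun p hp => by simp
      smul_mem' := fun c x hx p hp => by
        rw [ContinuousLinearMap.smul_comp, ContinuousLinearMap.comp_smul, ← hx p hp] }
  have halg : ∀ {a : E →L[ℂ] E}, a ∈ N.alg.toSubalgebra ↔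
      ∀ p ∈ N.carrier, a ∘L p = p ∘L a ∘L p := by
    intro a
    refine forall₂_congr fun p _ => ?_
    rw [sub_mul, sub_mul, one_mul, sub_eq_zero]
    rfl
  refine Set.Subset.antisymm (wstarSpan_subset (C := C) ?_ ?_) fun y hy => ?_
  · have := isWStarClosed_forall_inner_eq
      (ι := {p : N.doubleCommutant // (p : E →L[ℂ] E) ∈ N.carrier} × E × F)
      (fun i => (i.1.1 : E →L[ℂ] E) i.2.1) (fun i => (i.1.1 : E →L[ℂ] E) i.2.1) (fun i => i.2.2)
      (fun i => adjoint (Θ i.1.1) i.2.2)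
    convert this using 1
    ext y
    constructor
    · intro hy i
      rw [ContinuousLinearMap.adjoint_inner_left]
      exact congrArg (fun z : E →L[ℂ] F => ⟪i.2.2, z i.2.1⟫_ℂ) (hy i.1.1 i.1.2)
    · intro hy p hp
      ext h
      refine ext_inner_left ℂ fun k => ?_
      have := hy (⟨p, hp⟩, h, k)
      rwa [ContinuousLinearMap.adjoint_inner_left] at this
  · rintro _ ⟨t, ht, a, ha, rfl⟩ p hp
    calc (t ∘L a) ∘L (p : E →L[ℂ] E) = (t ∘L (p : E →L[ℂ] E)) ∘L a ∘L (p : E →L[ℂ] E) := by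
          rw [ContinuousLinearMap.comp_assoc, ContinuousLinearMap.comp_assoc, ← halg.1 ha _ hp]
      _ = Θ p ∘L (t ∘L a) ∘L (p : E →L[ℂ] E) := by
          rw [hTΘ p hp t ht, ContinuousLinearMap.comp_assoc, ContinuousLinearMap.comp_assoc]
  · have hT' : ∀ x ∈ adjointSpace T, ∀ y ∈ adjointSpace T, ∀ z ∈ adjointSpace T,
        x ∘L adjoint y ∘L z ∈ adjointSpace T := by
      intro x hx y hy z hz
      have := hT _ hz _ hy _ hx
      rw [mem_adjointSpace]
      simpa [ContinuousLinearMap.adjoint_comp, ContinuousLinearMap.comp_assoc] using this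
    have key := mem_wstarClosure_adjointMulSpan hT' y fun v hv => hY y hy v fun t ht =>
      hv _ (by simpa using ht)
    let _ := wstarTopology E F
    refine closure_mono ?_ key
    rintro _ ⟨d, hd, rfl⟩
    induction hd using Submodule.span_induction with
    | mem d hd =>
      obtain ⟨s, hs, t, ht, rfl⟩ := hd
      refine Submodule.subset_span ⟨adjoint s, hs, t ∘L y, halg.2 fun p hp => ?_, rfl⟩
      have hp' := N.carrier_subset_doubleCommutant hp
      have h1 : p ∘L t = t ∘L Θ ⟨p, hp'⟩ := by
        have := congrArg adjoint (hTΘ ⟨p, hp'⟩ hp _ ht)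
        rwa [ContinuousLinearMap.adjoint_comp, ContinuousLinearMap.adjoint_comp,
          ContinuousLinearMap.adjoint_adjoint, (hΘ ⟨p, hp'⟩ hp).adjoint_eq,
          (N.isStarProjection _ hp).isSelfAdjoint.adjoint_eq] at this
      have h2 := hy ⟨p, hp'⟩ hp
      rw [ContinuousLinearMap.comp_assoc]
      conv_lhs => rw [h2]
      simp only [← ContinuousLinearMap.comp_assoc]
      rw [h1]
    | zero => rw [ContinuousLinearMap.zero_comp]; exact zero_mem _
    | add a b _ _ ha hb => rw [ContinuousLinearMap.add_comp]; exact add_mem ha hb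
    | smul a d _ hd => rw [ContinuousLinearMap.smul_comp]; exact Submodule.smul_mem _ _ hd

end Ternary

/-! ### The isomorphism of commutants induced by a nondegenerate space of operators -/

section Intertwiners

variable {E : Type*} [NormedAddCommGroup E] [InnerProductSpace ℂ E] [CompleteSpace E]
  {F : Type*} [NormedAddCommGroup F] [InnerProductSpace ℂ F] [CompleteSpace F]

/-- `T` intertwines `x` and `z`: `z t = t x` and `t* z = x t*` for all `t ∈ T`. -/
def Intertwines (T : Submodule ℂ (E →L[ℂ] F)) (x : E →L[ℂ] E) (z : F →L[ℂ] F) : Prop :=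
  ∀ t ∈ T, (∀ h, z (t h) = t (x h)) ∧ ∀ k, adjoint t (z k) = x (adjoint t k)

/-- `T` acts nondegenerately on both sides: `T` kills no vector of `E` and `T*` no vector of `F`,
except `0`. -/
structure Nondegenerate (T : Submodule ℂ (E →L[ℂ] F)) : Prop where
  left : ∀ h : E, (∀ t ∈ T, t h = 0) → h = 0
  right : ∀ k : F, (∀ t ∈ T, adjoint t k = 0) → k = 0

variable {T : Submodule ℂ (E →L[ℂ] F)}

theorem Nondegenerate.adjointSpace (hT : Nondegenerate T) : Nondegenerate (adjointSpace T) where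
  left k hk := hT.right k fun t ht => hk _ (by simpa using ht)
  right h hh := hT.left h fun t ht => by simpa using hh (adjoint t) (by simpa using ht)

theorem Intertwines.adjointSpace {x : E →L[ℂ] E} {z : F →L[ℂ] F} (h : Intertwines T x z) :
    Intertwines (adjointSpace T) z x := by
  intro s hs
  have := h _ hs
  rw [ContinuousLinearMap.adjoint_adjoint] at this
  exact ⟨fun k => (this.2 k).symm, fun k => (this.1 k).symm⟩

theorem intertwines_adjointSpace_iff {x : E →L[ℂ] E} {z : F →L[ℂ] F} :
    Intertwines (NestModule.adjointSpace T) z x ↔ Intertwines T x z := by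
  refine ⟨fun h t ht => ?_, Intertwines.adjointSpace⟩
  have := h (adjoint t) (by simpa using ht)
  rw [ContinuousLinearMap.adjoint_adjoint] at this
  exact ⟨fun k => (this.2 k).symm, fun k => (this.1 k).symm⟩

/-- The ranges of the operators in `T` span a dense subspace. -/
theorem denseRange_lsum (hF : ∀ k : F, (∀ t ∈ T, adjoint t k = 0) → k = 0) :
    DenseRange (Finsupp.lsum ℂ (fun t : T => ((t : E →L[ℂ] F) : E →ₗ[ℂ] F))) := by
  change Dense (Set.range _)
  rw [← LinearMap.coe_range, Submodule.dense_iff_topologicalClosure_eq_top,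
    Submodule.topologicalClosure_eq_top_iff, Submodule.eq_bot_iff]
  intro k hk
  refine hF k fun t ht => ?_
  rw [← inner_self_eq_zero (𝕜 := ℂ), ContinuousLinearMap.adjoint_inner_right]
  refine (Submodule.mem_orthogonal _ _).1 hk _ ⟨Finsupp.single ⟨t, ht⟩ (adjoint t k), ?_⟩
  simp

theorem eq_of_comp_eq (hF : ∀ k : F, (∀ t ∈ T, adjoint t k = 0) → k = 0)
    {G : Type*} [NormedAddCommGroup G] [InnerProductSpace ℂ G]
    {c d : F →L[ℂ] G} (h : ∀ t ∈ T, ∀ e, c (t e) = d (t e)) : c = d := by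
  refine DFunLike.coe_injective ((denseRange_lsum hF).equalizer c.continuous d.continuous ?_)
  funext f
  induction f using Finsupp.induction_linear with
  | zero => simp
  | add f g hf hg => simp only [Function.comp_apply, map_add] at *; rw [hf, hg]
  | single t e => simpa using h t t.2 e

/-- An operator `x` that commutes with `T* T` extends along `T`: as `c = (‖x‖² - x* x)^{1/2}` also
commutes with `T* T`, one has `‖∑ t x h‖² + ‖∑ t c h‖² = ‖x‖² ‖∑ t h‖²`, so `t h ↦ t x h` is
bounded. -/
theorem exists_comp_eq (hF : ∀ k : F, (∀ t ∈ T, adjoint t k = 0) → k = 0)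
    {x : E →L[ℂ] E} (hx : ∀ s ∈ T, ∀ t ∈ T, Commute x (adjoint s ∘L t)) :
    ∃ z : F →L[ℂ] F, ∀ t ∈ T, ∀ h, z (t h) = t (x h) := by
  let Φ : (E →L[ℂ] E) → (T →₀ E) →ₗ[ℂ] F := fun a =>
    Finsupp.lsum ℂ (fun t : T => (((t : E →L[ℂ] F) ∘L a : E →L[ℂ] F) : E →ₗ[ℂ] F))
  have hΦs : ∀ a t e, Φ a (Finsupp.single t e) = (t : E →L[ℂ] F) (a e) := fun a t e => by
    simp [Φ]
  have hΦ : ∀ a : E →L[ℂ] E, (∀ s ∈ T, ∀ t ∈ T, Commute a (adjoint s ∘L t)) →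
      ∀ f g, ⟪Φ a f, Φ a g⟫_ℂ = ⟪Φ 1 f, Φ (star a * a) g⟫_ℂ := by
    intro a ha f g
    induction f using Finsupp.induction_linear with
    | zero => simp
    | add f f' hf hf' => rw [map_add, map_add, inner_add_left, inner_add_left, hf, hf']
    | single s u =>
      induction g using Finsupp.induction_linear with
      | zero => simp
      | add g g' hg hg' => rw [map_add, map_add, inner_add_right, inner_add_right, hg, hg']
      | single t v =>
        rw [hΦs, hΦs, hΦs, hΦs]
        have h2 : Commute (star a) (adjoint (s : E →L[ℂ] F) ∘L (t : E →L[ℂ] F)) := by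
          have := (ha t t.2 s s.2).star_star
          simpa [ContinuousLinearMap.star_eq_adjoint, ContinuousLinearMap.adjoint_comp] using this
        have h3 : (adjoint (s : E →L[ℂ] F)) ((t : E →L[ℂ] F) ((star a * a) v)) =
            star a ((adjoint (s : E →L[ℂ] F)) ((t : E →L[ℂ] F) (a v))) :=
          congrArg (fun z : E →L[ℂ] E => z (a v)) h2.eq.symm
        rw [← ContinuousLinearMap.adjoint_inner_right (s : E →L[ℂ] F) (a u),
          ← ContinuousLinearMap.adjoint_inner_right a,
          ← ContinuousLinearMap.adjoint_inner_right (s : E →L[ℂ] F) _ ((t : E →L[ℂ] F) _), h3]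
        rfl
  have hpos : 0 ≤ algebraMap ℝ (E →L[ℂ] E) (‖x‖ ^ 2) - star x * x := by
    rw [sub_nonneg]
    exact CStarAlgebra.star_mul_le_algebraMap_norm_sq
  set c := CFC.sqrt (algebraMap ℝ (E →L[ℂ] E) (‖x‖ ^ 2) - star x * x) with hc
  have hcc : star c * c = algebraMap ℝ (E →L[ℂ] E) (‖x‖ ^ 2) - star x * x := by
    rw [(CFC.sqrt_nonneg _).isSelfAdjoint.star_eq, CFC.sqrt_mul_sqrt_self _ hpos]
  have hccomm : ∀ s ∈ T, ∀ t ∈ T, Commute c (adjoint s ∘L t) := by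
    intro s hs t ht
    rw [hc, CFC.sqrt_eq_cfc]
    refine Commute.cfc_nnreal ?_ _
    refine Commute.sub_left (Algebra.commutes _ _) (Commute.mul_left ?_ (hx s hs t ht))
    have := (hx t ht s hs).star_star
    simpa [ContinuousLinearMap.star_eq_adjoint, ContinuousLinearMap.adjoint_comp] using this
  have hbound : ∀ f, ‖Φ x f‖ ≤ ‖x‖ * ‖Φ 1 f‖ := by
    intro f
    have h3 : Φ (star c * c) f = ((‖x‖ ^ 2 : ℝ) : ℂ) • Φ 1 f - Φ (star x * x) f := by
      rw [hcc]
      induction f using Finsupp.induction_linear with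
      | zero => simp
      | add f g hf hg => rw [map_add, map_add, map_add, hf, hg, smul_add]; abel
      | single t e =>
        rw [hΦs, hΦs, hΦs, Algebra.algebraMap_eq_smul_one]
        simp [-Complex.ofReal_pow, Complex.coe_smul]
    have h1 := hΦ x hx f f
    have h2 := hΦ c hccomm f f
    rw [h3, inner_sub_right, inner_smul_right, ← h1, inner_self_eq_norm_sq_to_K,
      inner_self_eq_norm_sq_to_K, inner_self_eq_norm_sq_to_K] at h2
    have h4 : ‖Φ c f‖ ^ 2 = ‖x‖ ^ 2 * ‖Φ 1 f‖ ^ 2 - ‖Φ x f‖ ^ 2 := by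
      apply Complex.ofReal_injective
      push_cast at h2 ⊢
      exact h2
    refine le_of_sq_le_sq ?_ (by positivity)
    nlinarith [sq_nonneg ‖Φ c f‖]
  refine ⟨(Φ x).extendOfNorm (Φ 1), fun t ht h => ?_⟩
  have := LinearMap.extendOfNorm_eq (f := Φ x) (e := Φ 1) (denseRange_lsum hF) ⟨‖x‖, hbound⟩
    (Finsupp.single ⟨t, ht⟩ h)
  rwa [hΦs, hΦs] at this

namespace Intertwines

variable {x x' : E →L[ℂ] E} {z z' : F →L[ℂ] F}

theorem add (h : Intertwines T x z) (h' : Intertwines T x' z') :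
    Intertwines T (x + x') (z + z') := fun t ht =>
  ⟨fun e => by simp [(h t ht).1, (h' t ht).1], fun k => by simp [(h t ht).2, (h' t ht).2]⟩

theorem mul (h : Intertwines T x z) (h' : Intertwines T x' z') :
    Intertwines T (x * x') (z * z') := fun t ht =>
  ⟨fun e => by simp [(h t ht).1, (h' t ht).1], fun k => by simp [(h t ht).2, (h' t ht).2]⟩

theorem smul (h : Intertwines T x z) (c : ℂ) : Intertwines T (c • x) (c • z) := fun t ht =>
  ⟨fun e => by simp [(h t ht).1], fun k => by simp [(h t ht).2]⟩

theorem zero : Intertwines T 0 0 := fun t ht => ⟨fun e => by simp, fun k => by simp⟩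

theorem one : Intertwines T 1 1 := fun _ _ => ⟨fun _ => rfl, fun _ => rfl⟩

theorem star (h : Intertwines T x z) : Intertwines T (star x) (star z) := fun t ht =>
  ⟨fun e => ext_inner_left ℂ fun k => by
    rw [ContinuousLinearMap.star_eq_adjoint, ContinuousLinearMap.star_eq_adjoint,
      ContinuousLinearMap.adjoint_inner_right, ← ContinuousLinearMap.adjoint_inner_left,
      (h t ht).2, ← ContinuousLinearMap.adjoint_inner_left t,
      ContinuousLinearMap.adjoint_inner_right],
  fun k => ext_inner_left ℂ fun e => by
    rw [ContinuousLinearMap.star_eq_adjoint, ContinuousLinearMap.star_eq_adjoint,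
      ContinuousLinearMap.adjoint_inner_right, ContinuousLinearMap.adjoint_inner_right,
      (h t ht).1, ContinuousLinearMap.adjoint_inner_right,
      ContinuousLinearMap.adjoint_inner_right]⟩

theorem right_unique (hT : Nondegenerate T) (h : Intertwines T x z) (h' : Intertwines T x z') :
    z = z' :=
  eq_of_comp_eq hT.right fun t ht e => by rw [(h t ht).1, (h' t ht).1]

theorem left_unique (hT : Nondegenerate T) (h : Intertwines T x z) (h' : Intertwines T x' z) :
    x = x' :=
  right_unique hT.adjointSpace h.adjointSpace h'.adjointSpace

theorem exists_right (hT : Nondegenerate T)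
    (hx : ∀ s ∈ T, ∀ t ∈ T, Commute x (adjoint s ∘L t)) : ∃ z, Intertwines T x z := by
  obtain ⟨z, hz⟩ := exists_comp_eq hT.right hx
  refine ⟨z, fun t ht => ⟨hz t ht, fun k => ?_⟩⟩
  have : adjoint t ∘L z = x ∘L adjoint t := eq_of_comp_eq hT.right fun s hs e => by
    have := congrArg (fun y : E →L[ℂ] E => y e) (hx t ht s hs).eq
    simpa [hz s hs] using this.symm
  exact congrArg (fun y : F →L[ℂ] E => y k) this

theorem exists_left (hT : Nondegenerate T)
    (hz : ∀ s ∈ T, ∀ t ∈ T, Commute z (s ∘L adjoint t)) : ∃ x, Intertwines T x z := by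
  obtain ⟨x, hx⟩ := exists_right (x := z) hT.adjointSpace fun s hs t ht => by
    simpa using hz _ hs _ ht
  exact ⟨x, intertwines_adjointSpace_iff.1 hx⟩

/-- The correspondence of commutants restricts to double commutants: if `w` commutes with the
partners of `S` then `t* w s` commutes with `S`, hence with every `x ∈ S''`. -/
theorem mem_centralizer_centralizer (hT : Nondegenerate T) {S : Set (E →L[ℂ] E)}
    {S' : Set (F →L[ℂ] F)} (hS : ∀ p ∈ S, ∃ q ∈ S', Intertwines T p q)
    (h : Intertwines T x z) (hx : x ∈ S.centralizer.centralizer) :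
    z ∈ S'.centralizer.centralizer := by
  intro w hw
  refine eq_of_comp_eq hT.right fun s hs e => ?_
  rw [← sub_eq_zero]
  refine hT.right _ fun t ht => ?_
  have hmem : adjoint t ∘L w ∘L s ∈ S.centralizer := by
    intro p hp
    obtain ⟨q, hq, hpq⟩ := hS p hp
    ext e
    change p (adjoint t (w (s e))) = adjoint t (w (s (p e)))
    rw [← (hpq s hs).1, ← (hpq t ht).2]
    exact congrArg (fun y : F →L[ℂ] F => adjoint t (y (s e))) (hw q hq)
  have := congrArg (fun y : E →L[ℂ] E => y e) (hx _ hmem)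
  change adjoint t (w (s (x e))) = x (adjoint t (w (s e))) at this
  rw [map_sub, sub_eq_zero]
  change adjoint t (w (z (s e))) = adjoint t (z (w (s e)))
  rw [(h s hs).1, (h t ht).2, this]

end Intertwines

end Intertwiners

/-! ### The transported nest -/

section Transport

variable {E : Type*} [NormedAddCommGroup E] [InnerProductSpace ℂ E] [CompleteSpace E]
  {F : Type*} [NormedAddCommGroup F] [InnerProductSpace ℂ F] [CompleteSpace F]
  {T : Submodule ℂ (E →L[ℂ] F)}

theorem range_le_range_iff {p q : E →L[ℂ] E} (hq : IsStarProjection q) :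
    p.range ≤ q.range ↔ q * p = p := by
  constructor
  · intro h
    ext v
    obtain ⟨w, hw⟩ := h ⟨v, rfl⟩
    change q w = p v at hw
    change q (p v) = p v
    rw [← hw]
    exact congrArg (fun y : E →L[ℂ] E => y w) hq.isIdempotentElem
  · rintro h _ ⟨v, rfl⟩
    exact ⟨p v, congrArg (fun y : E →L[ℂ] E => y v) h⟩

theorem mem_range_iff {q : E →L[ℂ] E} (hq : IsStarProjection q) {v : E} :
    v ∈ q.range ↔ q v = v := by
  constructor
  · rintro ⟨w, rfl⟩
    exact congrArg (fun y : E →L[ℂ] E => y w) hq.isIdempotentElem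
  · exact fun h => ⟨v, h⟩

theorem Intertwines.isStarProjection (hT : Nondegenerate T) {p : E →L[ℂ] E} {q : F →L[ℂ] F}
    (h : Intertwines T p q) (hp : IsStarProjection p) : IsStarProjection q where
  isIdempotentElem := by
    refine (Intertwines.right_unique hT (h.mul h) ?_)
    rwa [hp.isIdempotentElem.eq]
  isSelfAdjoint := by
    refine (Intertwines.right_unique hT h.star ?_)
    rwa [hp.isSelfAdjoint.star_eq]

/-- The nest on `F` of the partners of the projections in a nest `N` on `E`, along a nondegenerate
`T` with `T* T ⊆ N'`. -/
def Nest.transport (N : Nest E) (hT : Nondegenerate T)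
    (hN : ∀ p ∈ N.carrier, ∀ s ∈ T, ∀ t ∈ T, Commute p (adjoint s ∘L t)) : Nest F where
  carrier := {q | ∃ p ∈ N.carrier, Intertwines T p q}
  isStarProjection := by
    rintro q ⟨p, hp, h⟩
    exact h.isStarProjection hT (N.isStarProjection p hp)
  total := by
    have key : ∀ {p p' q q'}, p' ∈ N.carrier → Intertwines T p q → Intertwines T p' q' →
        p.range ≤ p'.range → q.range ≤ q'.range := by
      intro p p' q q' hp' h h' hle
      have hp'' := N.isStarProjection p' hp'
      rw [range_le_range_iff hp''] at hle
      rw [range_le_range_iff (h'.isStarProjection hT hp'')]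
      refine Intertwines.right_unique hT (h'.mul h) ?_
      rwa [hle]
    rintro q ⟨p, hp, h⟩ q' ⟨p', hp', h'⟩
    exact (N.total p hp p' hp').imp (key hp' h h') (key hp h' h)
  zero_mem := ⟨0, N.zero_mem, Intertwines.zero⟩
  one_mem := ⟨1, N.one_mem, Intertwines.one⟩
  inter_mem := by
    intro S hS
    obtain ⟨r, hr, hrange⟩ := N.inter_mem {p ∈ N.carrier | ∃ q ∈ S, Intertwines T p q}
      fun p hp => hp.1
    obtain ⟨r', hr'⟩ := Intertwines.exists_right hT (hN r hr)
    have hr₁ := N.isStarProjection r hr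
    have hr'' := hr'.isStarProjection hT hr₁
    refine ⟨r', ⟨r, hr, hr'⟩, le_antisymm ?_ ?_⟩
    · refine le_iInf₂ fun q hq => ?_
      obtain ⟨p, hp, h⟩ := hS hq
      have hp₁ := N.isStarProjection p hp
      have hle : r.range ≤ p.range := hrange.le.trans (iInf₂_le p ⟨hp, q, hq, h⟩)
      rw [range_le_range_iff hp₁] at hle
      rw [range_le_range_iff (h.isStarProjection hT hp₁)]
      refine Intertwines.right_unique hT (h.mul hr') ?_
      rwa [hle]
    -- If all partners of the `p` fix `k` then all the `p`, and hence `r`, fix every `t* k`.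
    · intro k hk
      rw [mem_range_iff hr'', ← sub_eq_zero]
      refine hT.right _ fun t ht => ?_
      rw [map_sub, (hr' t ht).2, sub_eq_zero, ← mem_range_iff hr₁, hrange]
      simp only [Submodule.mem_iInf] at hk ⊢
      rintro p ⟨hp, q, hq, h⟩
      have hp₁ := N.isStarProjection p hp
      rw [mem_range_iff hp₁, ← (h t ht).2, (mem_range_iff (h.isStarProjection hT hp₁)).1 (hk q hq)]
  closedSpan_mem := by
    intro S hS
    obtain ⟨r, hr, hrange⟩ := N.closedSpan_mem {p ∈ N.carrier | ∃ q ∈ S, Intertwines T p q}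
      fun p hp => hp.1
    obtain ⟨r', hr'⟩ := Intertwines.exists_right hT (hN r hr)
    have hr₁ := N.isStarProjection r hr
    have hr'' := hr'.isStarProjection hT hr₁
    refine ⟨r', ⟨r, hr, hr'⟩, le_antisymm ?_ ?_⟩
    -- The range of `r'` is generated by the vectors `r' t e = t r e`, and `t` maps the range of `p`
    -- into the range of its partner.
    · have hV : IsClosed ((r' : F →L[ℂ] F) ⁻¹'
          ((⨆ q ∈ S, q.range).topologicalClosure : Set F)) :=
        (Submodule.isClosed_topologicalClosure _).preimage r'.continuous
      rintro _ ⟨k, rfl⟩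
      refine (denseRange_lsum hT.right).induction_on k hV fun f => ?_
      induction f using Finsupp.induction_linear with
      | zero => simp
      | add f g hf hg =>
        rw [map_add]
        change r' _ ∈ (_ : Submodule ℂ F)
        rw [map_add]
        exact add_mem hf hg
      | single t e =>
        change r' _ ∈ (⨆ q ∈ S, q.range).topologicalClosure
        rw [Finsupp.lsum_single]
        change r' ((t : E →L[ℂ] F) e) ∈ _
        rw [(hr' t t.2).1]
        have hre : r e ∈ (⨆ p ∈ {p ∈ N.carrier | ∃ q ∈ S, Intertwines T p q},
            p.range).topologicalClosure := hrange ▸ ⟨e, rfl⟩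
        refine map_mem_closure (t : E →L[ℂ] F).continuous hre fun v hv => ?_
        have hle : (⨆ p ∈ {p ∈ N.carrier | ∃ q ∈ S, Intertwines T p q}, p.range) ≤
            (⨆ q ∈ S, q.range).comap ((t : E →L[ℂ] F) : E →ₗ[ℂ] F) := by
          refine iSup₂_le ?_
          rintro p ⟨hp, q, hq, h⟩ _ ⟨e, rfl⟩
          refine (le_iSup₂ (f := fun (q : F →L[ℂ] F) (_ : q ∈ S) => q.range) q hq)
            ⟨(t : E →L[ℂ] F) e, (h t t.2).1 e⟩
        exact hle hv
    · refine Submodule.topologicalClosure_minimal _ (iSup₂_le fun q hq => ?_) ?_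
      · obtain ⟨p, hp, h⟩ := hS hq
        have hle : p.range ≤ r.range := (le_iSup₂ (f := fun (p : E →L[ℂ] E)
          (_ : p ∈ {p ∈ N.carrier | ∃ q ∈ S, Intertwines T p q}) => p.range) p
            ⟨hp, q, hq, h⟩).trans ((Submodule.le_topologicalClosure _).trans hrange.ge)
        rw [range_le_range_iff hr₁] at hle
        rw [range_le_range_iff hr'']
        refine Intertwines.right_unique hT (hr'.mul h) ?_
        rwa [hle]
      · have : (r'.range : Set F) = {k | r' k = k} := Set.ext fun k => mem_range_iff hr''
        rw [this]
        exact isClosed_eq r'.continuous continuous_id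

/-- A nondegenerate `T` with `T* T ⊆ N'` induces a `*`-isomorphism `θ` of `N''` onto the double
commutant of the transported nest, with `θ(x) t = t x`. -/
theorem Nest.exists_starAlgEquiv (N : Nest E) (hT : Nondegenerate T)
    (hN : ∀ p ∈ N.carrier, ∀ s ∈ T, ∀ t ∈ T, Commute p (adjoint s ∘L t)) :
    ∃ θ : N.doubleCommutant ≃⋆ₐ[ℂ] (N.transport hT hN).doubleCommutant,
      ∀ x : N.doubleCommutant, Intertwines T (x : E →L[ℂ] E) (θ x : F →L[ℂ] F) := by
  have h1 : ∀ x : N.doubleCommutant, ∃ z : (N.transport hT hN).doubleCommutant,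
      Intertwines T (x : E →L[ℂ] E) (z : F →L[ℂ] F) := by
    intro x
    have hx := Nest.mem_doubleCommutant.1 x.2
    obtain ⟨z, hz⟩ := Intertwines.exists_right hT (x := (x : E →L[ℂ] E)) fun s hs t ht =>
      (hx _ fun p hp => hN p hp s hs t ht).symm
    refine ⟨⟨z, Nest.mem_doubleCommutant.2 (hz.mem_centralizer_centralizer hT ?_ hx)⟩, hz⟩
    intro p hp
    obtain ⟨q, hq⟩ := Intertwines.exists_right hT (hN p hp)
    exact ⟨q, ⟨p, hp, hq⟩, hq⟩
  have h2 : ∀ z : (N.transport hT hN).doubleCommutant, ∃ x : N.doubleCommutant,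
      Intertwines T (x : E →L[ℂ] E) (z : F →L[ℂ] F) := by
    intro z
    have hz := Nest.mem_doubleCommutant.1 z.2
    obtain ⟨x, hx⟩ := Intertwines.exists_left hT (z := (z : F →L[ℂ] F)) fun s hs t ht => by
      refine (hz _ ?_).symm
      rintro q ⟨p, -, h⟩
      ext k
      change q (s (adjoint t k)) = s (adjoint t (q k))
      rw [(h s hs).1, (h t ht).2]
    refine ⟨⟨x, Nest.mem_doubleCommutant.2
      (hx.adjointSpace.mem_centralizer_centralizer hT.adjointSpace ?_ hz)⟩, hx⟩
    rintro q ⟨p, hp, h⟩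
    exact ⟨p, hp, h.adjointSpace⟩
  choose f hf using h1
  choose g hg using h2
  have huniq : ∀ {x : N.doubleCommutant} {z : (N.transport hT hN).doubleCommutant},
      Intertwines T (x : E →L[ℂ] E) (z : F →L[ℂ] F) → f x = z :=
    fun {x z} h => Subtype.ext (Intertwines.right_unique hT (hf x) h)
  exact ⟨{ toFun := f
           invFun := g
           left_inv := fun x => Subtype.ext (Intertwines.left_unique hT (hg (f x)) (hf x))
           right_inv := fun z => huniq (hg z)
           map_mul' := fun x y => huniq ((hf x).mul (hf y))
           map_add' := fun x y => huniq ((hf x).add (hf y))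
           map_star' := fun x => huniq (hf x).star
           map_smul' := fun c x => huniq ((hf x).smul c) }, hf⟩

end Transport

/-! ### Projections in an algebra equal to its double commutant -/

section DoubleCommutant

variable {E : Type*} [NormedAddCommGroup E] [InnerProductSpace ℂ E] [CompleteSpace E]
  {F : Type*} [NormedAddCommGroup F] [InnerProductSpace ℂ F] [CompleteSpace F]
  {𝒜 : StarSubalgebra ℂ (E →L[ℂ] E)} {ℬ : StarSubalgebra ℂ (F →L[ℂ] F)}

theorem star_mem_centralizer {z : E →L[ℂ] E} (hz : z ∈ Set.centralizer (𝒜 : Set (E →L[ℂ] E))) :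
    star z ∈ Set.centralizer (𝒜 : Set (E →L[ℂ] E)) := fun a ha => by
  simpa using (congrArg star (hz (star a) (star_mem ha))).symm

/-- The projection onto a subspace invariant under `𝒜'` belongs to `𝒜''`. -/
theorem starProjection_mem
    (h𝒜 : (𝒜 : Set (E →L[ℂ] E)).centralizer.centralizer ⊆ 𝒜)
    {U : Submodule ℂ E} [U.HasOrthogonalProjection]
    (hU : ∀ z ∈ Set.centralizer (𝒜 : Set (E →L[ℂ] E)), ∀ u ∈ U, z u ∈ U) :
    U.starProjection ∈ 𝒜 :=
  h𝒜 fun z hz => commute_starProjection (hU z hz) (hU _ (star_mem_centralizer hz))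

/-- Every vector `k` has a support projection in `𝒜`: its range is the closure of `𝒜' k`. -/
theorem exists_support (h𝒜 : (𝒜 : Set (E →L[ℂ] E)).centralizer.centralizer ⊆ 𝒜) (k : E) :
    ∃ e ∈ 𝒜, e k = k ∧ ∀ y ∈ 𝒜, y k = 0 → y * e = 0 := by
  let U₀ : Submodule ℂ E :=
    Submodule.span ℂ {v | ∃ z ∈ Set.centralizer (𝒜 : Set (E →L[ℂ] E)), v = z k}
  let U := U₀.topologicalClosure
  have : CompleteSpace U := U₀.isClosed_topologicalClosure.completeSpace_coe
  have hinv : ∀ z ∈ Set.centralizer (𝒜 : Set (E →L[ℂ] E)), ∀ u ∈ U, z u ∈ U := by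
    intro z hz u hu
    refine map_mem_closure z.continuous hu fun v hv => ?_
    change v ∈ U₀.comap (z : E →ₗ[ℂ] E)
    refine (Submodule.span_le.2 ?_) hv
    rintro _ ⟨z', hz', rfl⟩
    exact Submodule.subset_span ⟨z * z', Set.mul_mem_centralizer hz hz', rfl⟩
  refine ⟨U.starProjection, starProjection_mem h𝒜 hinv, ?_, fun y hy hyk => ?_⟩
  · rw [Submodule.starProjection_eq_self_iff]
    exact U₀.le_topologicalClosure (Submodule.subset_span ⟨1, Set.one_mem_centralizer, rfl⟩)
  · ext v
    have hle : U ≤ LinearMap.ker (y : E →ₗ[ℂ] E) := by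
      refine Submodule.topologicalClosure_minimal _ (Submodule.span_le.2 ?_)
        (ContinuousLinearMap.isClosed_ker y)
      rintro _ ⟨z, hz, rfl⟩
      have := congrArg (fun x : E →L[ℂ] E => x k) (hz y hy)
      change y (z k) = z (y k) at this
      change y (z k) = 0
      rw [this, hyk, map_zero]
    exact hle (U.starProjection_apply_mem v)

theorem exists_star_mul_self_eq (h𝒜 : (𝒜 : Set (E →L[ℂ] E)).centralizer.centralizer ⊆ 𝒜)
    {a : 𝒜} (ha : 0 ≤ (a : E →L[ℂ] E)) : ∃ y : 𝒜, a = star y * y := by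
  refine ⟨⟨CFC.sqrt (a : E →L[ℂ] E), h𝒜 fun z hz => ?_⟩, Subtype.ext ?_⟩
  · rw [CFC.sqrt_eq_cfc]
    have : Commute (a : E →L[ℂ] E) z := hz a a.2
    exact (this.cfc_nnreal _).symm
  · change (a : E →L[ℂ] E) = star (CFC.sqrt (a : E →L[ℂ] E)) * CFC.sqrt (a : E →L[ℂ] E)
    rw [(CFC.sqrt_nonneg _).isSelfAdjoint.star_eq, CFC.sqrt_mul_sqrt_self _ ha]

/-- A `*`-homomorphism on `𝒜` turns an inequality `p* p ≤ x* x` of operators into a bound for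
the images: the square root of the difference belongs to `𝒜`. -/
theorem norm_map_apply_le (h𝒜 : (𝒜 : Set (E →L[ℂ] E)).centralizer.centralizer ⊆ 𝒜)
    (θ : 𝒜 ≃⋆ₐ[ℂ] ℬ) {x p : 𝒜} (h : 0 ≤ ((star x * x - star p * p : 𝒜) : E →L[ℂ] E)) (k : F) :
    ‖(θ p : F →L[ℂ] F) k‖ ≤ ‖(θ x : F →L[ℂ] F) k‖ := by
  obtain ⟨y, hy⟩ := exists_star_mul_self_eq h𝒜 h
  have hn : ∀ z : ℬ, ⟪k, ((star z * z : ℬ) : F →L[ℂ] F) k⟫_ℂ = ‖(z : F →L[ℂ] F) k‖ ^ 2 := by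
    intro z
    change ⟪k, adjoint (z : F →L[ℂ] F) ((z : F →L[ℂ] F) k)⟫_ℂ = _
    rw [ContinuousLinearMap.adjoint_inner_right, inner_self_eq_norm_sq_to_K]
    rfl
  have h1 := congrArg (fun a => ⟪k, ((θ a : ℬ) : F →L[ℂ] F) k⟫_ℂ) hy
  have h2 : ⟪k, ((star (θ x) * θ x - star (θ p) * θ p : ℬ) : F →L[ℂ] F) k⟫_ℂ =
      ⟪k, ((star (θ x) * θ x : ℬ) : F →L[ℂ] F) k⟫_ℂ -
        ⟪k, ((star (θ p) * θ p : ℬ) : F →L[ℂ] F) k⟫_ℂ := inner_sub_right _ _ _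
  simp only [map_sub, map_mul, map_star] at h1
  rw [h2, hn, hn, hn] at h1
  have h3 : ‖(θ x : F →L[ℂ] F) k‖ ^ 2 - ‖(θ p : F →L[ℂ] F) k‖ ^ 2 =
      ‖(θ y : F →L[ℂ] F) k‖ ^ 2 := by exact_mod_cast h1
  refine le_of_sq_le_sq ?_ (norm_nonneg _)
  nlinarith [sq_nonneg ‖(θ y : F →L[ℂ] F) k‖]

/-- In a commutative `𝒜 = 𝒜''`, the spectral projection `p` of `x` for the region
`|1 - x| ≤ |x|` of the plane. On this region `1/2 ≤ |x|`, and `1/2 ≤ |1 - x|` off it. -/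
theorem exists_cut_projection (h𝒜 : (𝒜 : Set (E →L[ℂ] E)).centralizer.centralizer ⊆ 𝒜)
    (hcomm : ∀ x y : 𝒜, x * y = y * x) (x : 𝒜) :
    ∃ p : 𝒜, star p = p ∧ p * p = p ∧
      0 ≤ ((star (2 * x) * (2 * x) - star p * p : 𝒜) : E →L[ℂ] E) ∧
      0 ≤ ((star (2 * (1 - x)) * (2 * (1 - x)) - star (1 - p) * (1 - p) : 𝒜) : E →L[ℂ] E) := by
  set b : 𝒜 := star x * x - star (1 - x) * (1 - x) with hb
  have hbsa : IsSelfAdjoint (b : E →L[ℂ] E) := by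
    have : star b = b := by simp [hb]
    exact congrArg Subtype.val this
  have hcfc : ∀ f : ℝ → ℝ, cfcₙ f (b : E →L[ℂ] E) ∈ 𝒜 := fun f => h𝒜 fun z hz => by
    have : Commute (b : E →L[ℂ] E) z := hz b b.2
    exact (this.cfcₙ_real f).symm
  let u : 𝒜 := ⟨(b : E →L[ℂ] E)⁺, hcfc _⟩
  let v : 𝒜 := ⟨(b : E →L[ℂ] E)⁻, hcfc _⟩
  -- The kernel of the negative part of `b = |x|² - |1 - x|²` is the range of `p`.
  let U : Submodule ℂ E := LinearMap.ker ((v : E →L[ℂ] E) : E →ₗ[ℂ] E)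
  have : CompleteSpace U := (ContinuousLinearMap.isClosed_ker (v : E →L[ℂ] E)).completeSpace_coe
  let p : 𝒜 := ⟨U.starProjection, starProjection_mem h𝒜 fun z hz w hw => by
    have h1 := congrArg (fun y : E →L[ℂ] E => y w) (hz v v.2)
    change (v : E →L[ℂ] E) (z w) = z ((v : E →L[ℂ] E) w) at h1
    change (v : E →L[ℂ] E) (z w) = 0
    have hw' : (v : E →L[ℂ] E) w = 0 := hw
    rw [h1, hw', map_zero]⟩
  have hps : star p = p := Subtype.ext (isSelfAdjoint_starProjection U).star_eq
  have hpp : p * p = p := Subtype.ext U.isIdempotentElem_starProjection.eq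
  have huv : u - v = b := Subtype.ext (CFC.posPart_sub_negPart (b : E →L[ℂ] E) hbsa)
  have hvu : v * u = 0 := Subtype.ext (CFC.negPart_mul_posPart (b : E →L[ℂ] E))
  have hpu : p * u = u := by
    refine Subtype.ext (ContinuousLinearMap.ext fun w => ?_)
    change U.starProjection ((u : E →L[ℂ] E) w) = (u : E →L[ℂ] E) w
    rw [Submodule.starProjection_eq_self_iff]
    exact congrArg (fun y : 𝒜 => (y : E →L[ℂ] E) w) hvu
  have hvp : v * p = 0 :=
    Subtype.ext (ContinuousLinearMap.ext fun w => U.starProjection_apply_mem w)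
  have hu0 : 0 ≤ (u : E →L[ℂ] E) := CFC.posPart_nonneg _
  have hv0 : 0 ≤ (v : E →L[ℂ] E) := CFC.negPart_nonneg _
  have hsq : ∀ y : 𝒜, 0 ≤ ((star y * y : 𝒜) : E →L[ℂ] E) := fun y =>
    star_mul_self_nonneg (y : E →L[ℂ] E)
  have hs2 : star (2 : 𝒜) = 2 := star_ofNat 2
  let _ : CommRing 𝒜 := { (inferInstance : Ring 𝒜) with mul_comm := hcomm }
  -- Both identities rest on `|x|² + |1 - x|² = 1/2 + |2x - 1|²/2`.
  have e1 : star (2 * x) * (2 * x) - star p * p =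
      star (2 * (x * (1 - p))) * (2 * (x * (1 - p))) +
        star ((2 * x - 1) * p) * ((2 * x - 1) * p) + (u + u) := by
    simp only [star_mul, star_sub, star_one, hs2, hps] at hb ⊢
    linear_combination (2 * star x + 2 * x - 2 - 8 * star x * x) * hpp -
      2 * p * (huv.trans hb) + 2 * hpu - 2 * hvp
  have e2 : star (2 * (1 - x)) * (2 * (1 - x)) - star (1 - p) * (1 - p) =
      star (2 * ((1 - x) * p)) * (2 * ((1 - x) * p)) +
        star ((2 * x - 1) * (1 - p)) * ((2 * x - 1) * (1 - p)) + (v + v) := by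
    simp only [star_mul, star_sub, star_one, hs2, hps] at hb ⊢
    linear_combination (2 - 2 * star x - 2 * x - 8 * (1 - star x) * (1 - x)) * hpp +
      2 * (1 - p) * (huv.trans hb) - 2 * hvp + 2 * hpu
  refine ⟨p, hps, hpp, ?_, ?_⟩
  · rw [e1]
    exact add_nonneg (add_nonneg (hsq _) (hsq _)) (add_nonneg hu0 hu0)
  · rw [e2]
    exact add_nonneg (add_nonneg (hsq _) (hsq _)) (add_nonneg hv0 hv0)

/-- If `θ : 𝒜 ≃ ℬ` intertwines no operator `E → F` that is nonzero at `h` then, for every `k`,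
some `x ∈ 𝒜` has `x h ≈ h` and `θ(x) k ≈ 0`. Indeed, the projection onto the closure of
`{(x h, θ(x) k)}` commutes with all `x ⊕ θ(x)`, so one of its entries is an intertwiner; as this
entry kills `h`, the vector `(h, 0)` is in that closure. -/
theorem exists_approx_of_intertwiners_eq_zero (θ : 𝒜 ≃⋆ₐ[ℂ] ℬ) {h : E}
    (hh : ∀ t : E →L[ℂ] F, (∀ x : 𝒜, t ∘L (x : E →L[ℂ] E) = (θ x : F →L[ℂ] F) ∘L t) → t h = 0)
    (k : F) {ε : ℝ} (hε : 0 < ε) :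
    ∃ x : 𝒜, ‖h - (x : E →L[ℂ] E) h‖ < ε ∧ ‖(θ x : F →L[ℂ] F) k‖ < ε := by
  let W₀ : Submodule ℂ (WithLp 2 (E × F)) :=
    { carrier := {w | ∃ x : 𝒜, w = WithLp.toLp 2 ((x : E →L[ℂ] E) h, (θ x : F →L[ℂ] F) k)}
      add_mem' := by
        rintro _ _ ⟨x, rfl⟩ ⟨y, rfl⟩
        exact ⟨x + y, by rw [map_add]; rfl⟩
      zero_mem' := ⟨0, by rw [map_zero]; rfl⟩
      smul_mem' := by
        rintro c _ ⟨x, rfl⟩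
        exact ⟨c • x, by rw [map_smul]; rfl⟩ }
  let W := W₀.topologicalClosure
  have : CompleteSpace W := W₀.isClosed_topologicalClosure.completeSpace_coe
  let ι := WithLp.prodContinuousLinearEquiv 2 ℂ E F
  let δ : 𝒜 → (WithLp 2 (E × F) →L[ℂ] WithLp 2 (E × F)) := fun x =>
    (ι.symm : E × F →L[ℂ] WithLp 2 (E × F)) ∘L
      ((x : E →L[ℂ] E).prodMap (θ x : F →L[ℂ] F)) ∘L (ι : WithLp 2 (E × F) →L[ℂ] E × F)
  have hδ : ∀ x a c, δ x (WithLp.toLp 2 (a, c)) =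
      WithLp.toLp 2 ((x : E →L[ℂ] E) a, (θ x : F →L[ℂ] F) c) := fun x a c => rfl
  have hδadj : ∀ x, adjoint (δ x) = δ (star x) := by
    intro x
    symm
    rw [ContinuousLinearMap.eq_adjoint_iff]
    intro v w
    rw [WithLp.prod_inner_apply, WithLp.prod_inner_apply]
    have hx : ((star x : 𝒜) : E →L[ℂ] E) = adjoint (x : E →L[ℂ] E) := rfl
    have hθx : ((θ (star x) : ℬ) : F →L[ℂ] F) = adjoint (θ x : F →L[ℂ] F) := by
      rw [map_star]; rfl
    change ⟪((star x : 𝒜) : E →L[ℂ] E) v.fst, w.fst⟫_ℂ +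
      ⟪((θ (star x) : ℬ) : F →L[ℂ] F) v.snd, w.snd⟫_ℂ =
      ⟪v.fst, (x : E →L[ℂ] E) w.fst⟫_ℂ + ⟪v.snd, (θ x : F →L[ℂ] F) w.snd⟫_ℂ
    rw [hx, hθx, ContinuousLinearMap.adjoint_inner_left, ContinuousLinearMap.adjoint_inner_left]
  have hinv : ∀ x, ∀ w ∈ W, δ x w ∈ W := by
    intro x w hw
    refine map_mem_closure (δ x).continuous hw ?_
    rintro _ ⟨y, rfl⟩
    exact ⟨x * y, by rw [map_mul]; rfl⟩
  have hcomm : ∀ x, Commute (δ x) W.starProjection := fun x =>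
    commute_starProjection (hinv x) (by rw [hδadj]; exact hinv _)
  let inl : E →L[ℂ] WithLp 2 (E × F) :=
    (ι.symm : E × F →L[ℂ] WithLp 2 (E × F)) ∘L ContinuousLinearMap.inl ℂ E F
  let t : E →L[ℂ] F := WithLp.sndL 2 ℂ E F ∘L W.starProjection ∘L inl
  have ht : t h = 0 := by
    refine hh t fun x => ContinuousLinearMap.ext fun e => ?_
    have h1 : inl ((x : E →L[ℂ] E) e) = δ x (inl e) := by
      change WithLp.toLp 2 ((x : E →L[ℂ] E) e, (0 : F)) = δ x (WithLp.toLp 2 (e, (0 : F)))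
      rw [hδ, map_zero]
    have h2 : W.starProjection (δ x (inl e)) = δ x (W.starProjection (inl e)) :=
      (congrArg (fun y : WithLp 2 (E × F) →L[ℂ] WithLp 2 (E × F) => y (inl e)) (hcomm x).eq).symm
    change (W.starProjection (inl ((x : E →L[ℂ] E) e))).snd = _
    rw [h1, h2]
    rfl
  set h' : E := (W.starProjection (inl h)).fst with hh'
  have hP : W.starProjection (inl h) = WithLp.toLp 2 (h', (0 : F)) := by
    have : W.starProjection (inl h) =
        WithLp.toLp 2 ((W.starProjection (inl h)).fst, (W.starProjection (inl h)).snd) := rfl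
    rw [this]
    exact congrArg (fun c => WithLp.toLp 2 (h', c)) ht
  have hmem : WithLp.toLp 2 (h, k) ∈ W := W₀.le_topologicalClosure ⟨1, by rw [map_one]; rfl⟩
  have hperp : ∀ a c, WithLp.toLp 2 (a, c) ∈ W → ⟪h - h', a⟫_ℂ = 0 := by
    intro a c hw
    have := W.starProjection_inner_eq_zero (inl h) _ hw
    rw [hP, WithLp.prod_inner_apply] at this
    change ⟪h - h', a⟫_ℂ + ⟪(0 : F) - 0, c⟫_ℂ = 0 at this
    rwa [sub_zero, inner_zero_left, add_zero] at this
  have heq : h - h' = 0 := by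
    rw [← inner_self_eq_zero (𝕜 := ℂ), inner_sub_right, hperp h k hmem,
      hperp h' 0 (hP ▸ W.starProjection_apply_mem _), sub_zero]
  have hclos : inl h ∈ closure (W₀ : Set (WithLp 2 (E × F))) := by
    have h1 : W.starProjection (inl h) = inl h := by rw [hP, ← sub_eq_zero.1 heq]; rfl
    exact Submodule.starProjection_eq_self_iff.1 h1
  obtain ⟨_, ⟨x, rfl⟩, hx⟩ := Metric.mem_closure_iff.1 hclos ε hε
  rw [dist_eq_norm] at hx
  refine ⟨x, lt_of_le_of_lt ?_ hx, lt_of_le_of_lt ?_ hx⟩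
  · exact WithLp.norm_fst_le E
      (inl h - WithLp.toLp 2 ((x : E →L[ℂ] E) h, (θ x : F →L[ℂ] F) k))
  · have := WithLp.norm_snd_le E
      (inl h - WithLp.toLp 2 ((x : E →L[ℂ] E) h, (θ x : F →L[ℂ] F) k))
    change ‖(0 : F) - (θ x : F →L[ℂ] F) k‖ ≤ _ at this
    rwa [zero_sub, norm_neg] at this

/-- Projections `p n` in a commutative `𝒜 = 𝒜''` with `‖h - p n h‖ ≤ 2⁻ⁿ` have lower bounds
`q = ⋀_{n ≥ m} p n` in `𝒜`, for which `h - q h` is small when `m` is large: the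
products `p m ⋯ p (m + j) h` converge to a vector near `h` fixed by all `p n`, `n ≥ m`. -/
theorem exists_tail_projection (h𝒜 : (𝒜 : Set (E →L[ℂ] E)).centralizer.centralizer ⊆ 𝒜)
    (hcomm : ∀ x y : 𝒜, x * y = y * x) {h : E} {p : ℕ → 𝒜} (hstar : ∀ n, star (p n) = p n)
    (hidem : ∀ n, p n * p n = p n)
    (hp : ∀ n, ‖h - (p n : E →L[ℂ] E) h‖ ≤ (1 / 2) ^ n) (m : ℕ) :
    ∃ q : 𝒜, (∀ n, m ≤ n → q * p n = q) ∧ ‖h - (q : E →L[ℂ] E) h‖ ≤ 2 * (1 / 2) ^ m := by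
  have hproj : ∀ n, IsStarProjection (p n : E →L[ℂ] E) := fun n =>
    ⟨congrArg Subtype.val (hidem n), congrArg Subtype.val (hstar n)⟩
  let U : Submodule ℂ E := ⨅ n : {n // m ≤ n}, 
    LinearMap.eqLocus ((p n : E →L[ℂ] E) : E →ₗ[ℂ] E) LinearMap.id
  have hU : ∀ {w}, w ∈ U ↔ ∀ n, m ≤ n → (p n : E →L[ℂ] E) w = w := by
    intro w
    simp [U, Submodule.mem_iInf]
  have hclosed : IsClosed (U : Set E) := by
    have : (U : Set E) = ⋂ n, ⋂ (_ : m ≤ n), {w | (p n : E →L[ℂ] E) w = w} := by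
      ext w
      simp [hU]
    rw [this]
    exact isClosed_iInter fun n => isClosed_iInter fun _ =>
      isClosed_eq (p n : E →L[ℂ] E).continuous continuous_id
  have : CompleteSpace U := hclosed.completeSpace_coe
  let q : 𝒜 := ⟨U.starProjection, starProjection_mem h𝒜 fun z hz w hw => hU.2 fun n hn => by
    have := congrArg (fun y : E →L[ℂ] E => y w) (hz (p n) (p n).2)
    change (p n : E →L[ℂ] E) (z w) = z ((p n : E →L[ℂ] E) w) at this
    rw [this, hU.1 hw n hn]⟩
  refine ⟨q, fun n hn => ?_, ?_⟩
  · rw [hcomm]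
    exact Subtype.ext (ContinuousLinearMap.ext fun w => hU.1 (U.starProjection_apply_mem w) n hn)
  obtain ⟨P, hP0, hP⟩ : ∃ P : ℕ → 𝒜, P 0 = 1 ∧ ∀ j, P (j + 1) = p (m + j) * P j :=
    ⟨Nat.rec 1 fun j y => p (m + j) * y, rfl, fun _ => rfl⟩
  have hnorm : ∀ (j : ℕ) (w : E), ‖(P j : E →L[ℂ] E) w‖ ≤ ‖w‖ := by
    intro j w
    induction j with
    | zero => rw [hP0]; exact le_rfl
    | succ j ih =>
      rw [hP]
      refine le_trans ?_ ih
      have := (hproj (m + j)).norm_le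
      exact ((p (m + j) : E →L[ℂ] E).le_of_opNorm_le this _).trans_eq (one_mul _)
  have hfix : ∀ n, m ≤ n → ∀ j, n < m + j → p n * P j = P j := by
    intro n hn j hj
    induction j with
    | zero => omega
    | succ j ih =>
      rw [hP]
      rcases Nat.lt_succ_iff_lt_or_eq.1 (show n < (m + j).succ from hj) with hlt | rfl
      · rw [← mul_assoc, hcomm (p n), mul_assoc, ih hlt]
      · rw [← mul_assoc, hidem]
  have hdist : ∀ j, dist ((P j : E →L[ℂ] E) h) ((P (j + 1) : E →L[ℂ] E) h) ≤
      (1 / 2) ^ m * (1 / 2) ^ j := by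
    intro j
    rw [dist_eq_norm, hP, hcomm]
    change ‖(P j : E →L[ℂ] E) h - (P j : E →L[ℂ] E) ((p (m + j) : E →L[ℂ] E) h)‖ ≤ _
    rw [← map_sub, ← pow_add]
    exact (hnorm _ _).trans (hp _)
  obtain ⟨v, hv⟩ := cauchySeq_tendsto_of_complete
    (cauchySeq_of_le_geometric (1 / 2) ((1 / 2) ^ m) (by norm_num) hdist)
  have hvU : v ∈ U := by
    refine hU.2 fun n hn => tendsto_nhds_unique
      (((p n : E →L[ℂ] E).continuous.tendsto v).comp hv) (hv.congr' ?_)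
    filter_upwards [Filter.eventually_ge_atTop (n + 1)] with j hj
    exact (congrArg (fun y : 𝒜 => (y : E →L[ℂ] E) h) (hfix n hn j (by omega))).symm
  have hle := dist_le_of_le_geometric_of_tendsto₀ (1 / 2) ((1 / 2) ^ m) (by norm_num) hdist hv
  rw [hP0] at hle
  have hmin : ‖h - U.starProjection h‖ ≤ ‖h - v‖ := by
    rw [U.starProjection_minimal h]
    exact ciInf_le ⟨0, by rintro _ ⟨w, rfl⟩; exact norm_nonneg _⟩ (⟨v, hvU⟩ : U)
  refine hmin.trans ?_
  rw [← dist_eq_norm]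
  refine (show dist h v ≤ _ from hle).trans (le_of_eq ?_)
  ring

/-- Let `θ : 𝒜 ≃ ℬ` be a `*`-isomorphism of commutative algebras equal to their double commutants.
If all the operators `t` with `t x = θ(x) t` kill `h` then `h = 0`. -/
theorem eq_zero_of_intertwiners_eq_zero
    (h𝒜 : (𝒜 : Set (E →L[ℂ] E)).centralizer.centralizer ⊆ 𝒜)
    (hℬ : (ℬ : Set (F →L[ℂ] F)).centralizer.centralizer ⊆ ℬ)
    (hcomm : ∀ x y : 𝒜, x * y = y * x) (θ : 𝒜 ≃⋆ₐ[ℂ] ℬ) {h : E}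
    (hh : ∀ t : E →L[ℂ] F, (∀ x : 𝒜, t ∘L (x : E →L[ℂ] E) = (θ x : F →L[ℂ] F) ∘L t) →
      t h = 0) : h = 0 := by
  -- The preimage of the support of any `k` kills `h`.
  have key : ∀ k : F, ∃ s : 𝒜, (θ s : F →L[ℂ] F) k = k ∧ (s : E →L[ℂ] E) h = 0 := by
    intro k
    have hproj : ∀ n : ℕ, ∃ p : 𝒜, star p = p ∧ p * p = p ∧
        ‖h - (p : E →L[ℂ] E) h‖ ≤ (1 / 2) ^ n ∧ ‖(θ p : F →L[ℂ] F) k‖ ≤ (1 / 2) ^ n := by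
      intro n
      obtain ⟨x, hx, hθx⟩ := exists_approx_of_intertwiners_eq_zero θ hh k
        (show (0 : ℝ) < (1 / 2) ^ n / 2 by positivity)
      obtain ⟨p, hps, hpp, h1, h2⟩ := exists_cut_projection h𝒜 hcomm x
      refine ⟨p, hps, hpp, ?_, ?_⟩
      · have := norm_map_apply_le h𝒜 (StarAlgEquiv.refl ℂ 𝒜) h2 h
        change ‖h - (p : E →L[ℂ] E) h‖ ≤ ‖((2 * (1 - x) : 𝒜) : E →L[ℂ] E) h‖ at this
        rw [two_mul] at this
        change _ ≤ ‖(h - (x : E →L[ℂ] E) h) + (h - (x : E →L[ℂ] E) h)‖ at this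
        linarith [norm_add_le (h - (x : E →L[ℂ] E) h) (h - (x : E →L[ℂ] E) h)]
      · have := norm_map_apply_le h𝒜 θ h1 k
        rw [two_mul, map_add] at this
        change _ ≤ ‖(θ x : F →L[ℂ] F) k + (θ x : F →L[ℂ] F) k‖ at this
        linarith [norm_add_le ((θ x : F →L[ℂ] F) k) ((θ x : F →L[ℂ] F) k)]
    choose p hps hpp hph hpk using hproj
    obtain ⟨e, he, hek, hesupp⟩ := exists_support hℬ k
    have hzero : ∀ m, ∃ q : 𝒜, ‖h - (q : E →L[ℂ] E) h‖ ≤ 2 * (1 / 2) ^ m ∧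
        (θ.symm ⟨e, he⟩) * q = 0 := by
      intro m
      obtain ⟨q, hq, hqh⟩ := exists_tail_projection h𝒜 hcomm hps hpp hph m
      refine ⟨q, hqh, ?_⟩
      -- `‖θ(q) k‖ = ‖θ(q) θ(p n) k‖ ≤ ‖θ(q)‖ 2⁻ⁿ` for all `n ≥ m`.
      have hqk : (θ q : F →L[ℂ] F) k = 0 := by
        have hb : ∀ n, m ≤ n → ‖(θ q : F →L[ℂ] F) k‖ ≤ ‖(θ q : F →L[ℂ] F)‖ * (1 / 2) ^ n := by
          intro n hn
          have h1 : (θ q : F →L[ℂ] F) k = (θ q : F →L[ℂ] F) ((θ (p n) : F →L[ℂ] F) k) := by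
            conv_lhs => rw [← hq n hn, map_mul]
            rfl
          rw [h1]
          exact (θ q : F →L[ℂ] F).le_opNorm_of_le (hpk n)
        have hlim : Filter.Tendsto (fun n : ℕ => ‖(θ q : F →L[ℂ] F)‖ * (1 / 2 : ℝ) ^ n)
            Filter.atTop (𝓝 0) := by
          simpa using (tendsto_pow_atTop_nhds_zero_of_lt_one (r := (1 / 2 : ℝ)) (by norm_num)
            (by norm_num)).const_mul ‖(θ q : F →L[ℂ] F)‖
        exact norm_le_zero_iff.1
          (ge_of_tendsto hlim ((Filter.eventually_ge_atTop m).mono fun n hn => hb n hn))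
      rw [hcomm]
      refine EquivLike.injective θ ?_
      rw [map_mul, map_zero, StarAlgEquiv.apply_symm_apply]
      exact Subtype.ext (hesupp _ (θ q).2 hqk)
    refine ⟨θ.symm ⟨e, he⟩, by rw [StarAlgEquiv.apply_symm_apply]; exact hek, ?_⟩
    choose q hqh hq using hzero
    set s := θ.symm ⟨e, he⟩
    have hb : ∀ m, ‖(s : E →L[ℂ] E) h‖ ≤ ‖(s : E →L[ℂ] E)‖ * (2 * (1 / 2) ^ m) := by
      intro m
      have h1 : (s : E →L[ℂ] E) ((q m : E →L[ℂ] E) h) = 0 :=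
        congrArg (fun y : 𝒜 => (y : E →L[ℂ] E) h) (hq m)
      have h2 := (s : E →L[ℂ] E).le_opNorm_of_le (hqh m)
      rwa [map_sub, h1, sub_zero] at h2
    have hlim : Filter.Tendsto (fun m : ℕ => ‖(s : E →L[ℂ] E)‖ * (2 * (1 / 2 : ℝ) ^ m))
        Filter.atTop (𝓝 0) := by
      simpa using ((tendsto_pow_atTop_nhds_zero_of_lt_one (r := (1 / 2 : ℝ)) (by norm_num)
        (by norm_num)).const_mul 2).const_mul ‖(s : E →L[ℂ] E)‖
    exact norm_le_zero_iff.1 (ge_of_tendsto' hlim hb)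
  obtain ⟨f, hf, hfh, hfsupp⟩ := exists_support h𝒜 h
  have hθf : θ ⟨f, hf⟩ = 0 := by
    refine Subtype.ext (ContinuousLinearMap.ext fun k => ?_)
    obtain ⟨s, hs, hsh⟩ := key k
    have h1 : (⟨f, hf⟩ : 𝒜) * s = 0 := by
      rw [hcomm]
      exact Subtype.ext (hfsupp s s.2 hsh)
    have h2 := congrArg θ h1
    rw [map_mul, map_zero] at h2
    have h3 := congrArg (fun y : ℬ => (y : F →L[ℂ] F) k) h2
    change (θ ⟨f, hf⟩ : F →L[ℂ] F) ((θ s : F →L[ℂ] F) k) = 0 at h3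
    rwa [hs] at h3
  have hf0 : f = 0 := congrArg Subtype.val ((map_eq_zero_iff θ (EquivLike.injective θ)).1 hθf)
  rw [← hfh, hf0]
  rfl

end DoubleCommutant

/-! ### The two descriptions of the module -/

section Characterization

variable {H : Type*} [NormedAddCommGroup H] [InnerProductSpace ℂ H] [CompleteSpace H]
  {L : Type*} [NormedAddCommGroup L] [InnerProductSpace ℂ L] [CompleteSpace L]

theorem adjoint_subtypeL_coe {K : Submodule ℂ L} [CompleteSpace K] (k : K) :
    adjoint K.subtypeL (k : L) = k :=
  ext_inner_left ℂ fun k' => by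
    rw [ContinuousLinearMap.adjoint_inner_right]
    rfl

/-- The operator on `L` that acts as `z` on `K` and as `0` on the orthogonal complement of `K`. -/
def extendByZero {K : Submodule ℂ L} [CompleteSpace K] (z : K →L[ℂ] K) : L →L[ℂ] L :=
  K.subtypeL ∘L z ∘L adjoint K.subtypeL

theorem extendByZero_apply {K : Submodule ℂ L} [CompleteSpace K] (z : K →L[ℂ] K) (l : L) :
    extendByZero z l = z (adjoint K.subtypeL l) := rfl

theorem extendByZero_coe {K : Submodule ℂ L} [CompleteSpace K] (z : K →L[ℂ] K) (k : K) :
    extendByZero z (k : L) = z k := by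
  rw [extendByZero_apply, adjoint_subtypeL_coe]

theorem adjoint_extendByZero {K : Submodule ℂ L} [CompleteSpace K] (z : K →L[ℂ] K) :
    adjoint (extendByZero z) = extendByZero (star z) := by
  rw [extendByZero, ContinuousLinearMap.adjoint_comp, ContinuousLinearMap.adjoint_comp,
    ContinuousLinearMap.adjoint_adjoint, ContinuousLinearMap.comp_assoc]
  rfl

/-- The condition `y p = θ(p) y p` at `p = 1` says that `y` has range in `K`. -/
theorem image_opSpace {N : Nest H} {K : Submodule ℂ L} [CompleteSpace K] {M : Nest K}
    (θ : N.doubleCommutant ≃⋆ₐ[ℂ] M.doubleCommutant) :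
    (fun y : H →L[ℂ] K => K.subtypeL ∘L y) '' opSpace θ =
      {y : H →L[ℂ] L | ∀ p : N.doubleCommutant, (p : H →L[ℂ] H) ∈ N.carrier →
        y ∘L (p : H →L[ℂ] H) = extendByZero (θ p : K →L[ℂ] K) ∘L y ∘L (p : H →L[ℂ] H)} := by
  have hop : ∀ y : H →L[ℂ] K, y ∈ opSpace θ ↔ ∀ p : N.doubleCommutant,
      (p : H →L[ℂ] H) ∈ N.carrier → ∀ h,
        y ((p : H →L[ℂ] H) h) = (θ p : K →L[ℂ] K) (y ((p : H →L[ℂ] H) h)) := by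
    intro y
    refine forall₂_congr fun p _ => ?_
    rw [ContinuousLinearMap.sub_comp, sub_eq_zero, ContinuousLinearMap.ext_iff]
    rfl
  ext y
  constructor
  · rintro ⟨y, hy, rfl⟩ p hp
    ext h
    change ((y ((p : H →L[ℂ] H) h) : K) : L) =
      extendByZero (θ p : K →L[ℂ] K) ((y ((p : H →L[ℂ] H) h) : K) : L)
    rw [extendByZero_coe, ← (hop y).1 hy p hp]
  · intro hy
    refine ⟨adjoint K.subtypeL ∘L y, (hop _).2 fun p hp h => ?_, ?_⟩
    · have := congrArg (fun z : H →L[ℂ] L => adjoint K.subtypeL (z h)) (hy p hp)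
      change adjoint K.subtypeL (y ((p : H →L[ℂ] H) h)) = adjoint K.subtypeL
        (((θ p : K →L[ℂ] K) (adjoint K.subtypeL (y ((p : H →L[ℂ] H) h))) : K) : L) at this
      rwa [adjoint_subtypeL_coe] at this
    · have := hy 1 N.one_mem
      rw [map_one] at this
      exact this.symm

theorem Nest.commute_of_mem_alg {N : Nest H} {x : H →L[ℂ] H} (hx : x ∈ N.alg.toSubalgebra)
    (hx' : adjoint x ∈ N.alg.toSubalgebra) {p : H →L[ℂ] H} (hp : p ∈ N.carrier) :
    Commute p x := by
  have h1 : x * p = p * x * p := by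
    have := hx p hp
    rwa [sub_mul, sub_mul, one_mul, sub_eq_zero] at this
  have h2 : star x * p = p * star x * p := by
    have := hx' p hp
    rwa [sub_mul, sub_mul, one_mul, sub_eq_zero] at this
  have h3 := congrArg star h2
  simp only [star_mul, star_star, (N.isStarProjection p hp).isSelfAdjoint.star_eq] at h3
  calc p * x = p * (x * p) := h3
    _ = p * x * p := (mul_assoc p x p).symm
    _ = x * p := h1.symm

theorem Nest.commute_of_mem (N : Nest H) {p q : H →L[ℂ] H} (hp : p ∈ N.carrier)
    (hq : q ∈ N.carrier) : Commute p q := by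
  have key : ∀ {p q : H →L[ℂ] H}, p ∈ N.carrier → q ∈ N.carrier → p.range ≤ q.range →
      Commute p q := by
    intro p q hp hq h
    have h1 := (range_le_range_iff (N.isStarProjection q hq)).1 h
    have h2 := congrArg star h1
    rw [star_mul, (N.isStarProjection p hp).isSelfAdjoint.star_eq,
      (N.isStarProjection q hq).isSelfAdjoint.star_eq] at h2
    exact h2.trans h1.symm
  exact (N.total p hp q hq).elim (key hp hq) fun h => (key hq hp h).symm

theorem Nest.doubleCommutant_mul_comm (N : Nest H) (x y : N.doubleCommutant) : x * y = y * x := by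
  have hx := Nest.mem_doubleCommutant.1 x.2
  have hy := Nest.mem_doubleCommutant.1 y.2
  refine Subtype.ext (hy _ fun p hp => ?_)
  exact (hx _ fun q hq => N.commute_of_mem hq hp)

theorem Nest.centralizer_centralizer_doubleCommutant (N : Nest H) :
    (N.doubleCommutant : Set (H →L[ℂ] H)).centralizer.centralizer ⊆ N.doubleCommutant := by
  rw [N.coe_doubleCommutant, Set.centralizer_centralizer_centralizer]

/-- The closed span `K` of the ranges of a ternary ring `T` whose products generate the unit
carries the image of the nest, and the module generated by `T` consists of the operators
`H → K` compatible with the two nests. -/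
theorem IsConcreteStronglyProjective.exists_nest {N : Nest H} {Y : Submodule ℂ (H →L[ℂ] L)}
    (hY : IsConcreteStronglyProjective N.alg Y) :
    ∃ (K : Submodule ℂ L) (_ : CompleteSpace K) (M : Nest K)
      (θ : N.doubleCommutant ≃⋆ₐ[ℂ] M.doubleCommutant),
      θ '' {p : N.doubleCommutant | (p : H →L[ℂ] H) ∈ N.carrier} =
        {q : M.doubleCommutant | (q : K →L[ℂ] K) ∈ M.carrier} ∧
      (Y : Set (H →L[ℂ] L)) = (fun y : H →L[ℂ] K => K.subtypeL ∘L y) '' opSpace θ := by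
  obtain ⟨T, hT, hTA, h1, hYeq⟩ := hY
  let K : Submodule ℂ L := (⨆ t ∈ T, t.range).topologicalClosure
  have hK : CompleteSpace K := (Submodule.isClosed_topologicalClosure _).completeSpace_coe
  let T' : Submodule ℂ (H →L[ℂ] K) :=
    { carrier := {t | K.subtypeL ∘L t ∈ T}
      add_mem' := fun {s t} hs ht => by
        have hs' : K.subtypeL ∘L s ∈ T := hs
        have ht' : K.subtypeL ∘L t ∈ T := ht
        change K.subtypeL ∘L (s + t) ∈ T
        rw [ContinuousLinearMap.comp_add]
        exact T.add_mem hs' ht'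
      zero_mem' := by simp
      smul_mem' := fun c t ht => by
        have ht' : K.subtypeL ∘L t ∈ T := ht
        change K.subtypeL ∘L (c • t) ∈ T
        rw [ContinuousLinearMap.comp_smul]
        exact T.smul_mem c ht' }
  have hmemK : ∀ t ∈ T, ∀ h, t h ∈ K := fun t ht h =>
    Submodule.le_topologicalClosure _ ((le_iSup₂ (f := fun (t : H →L[ℂ] L) (_ : t ∈ T) => t.range)
      t ht) ⟨h, rfl⟩)
  have hlift : ∀ t ∈ T, ∃ t' ∈ T', K.subtypeL ∘L t' = t := fun t ht =>
    ⟨t.codRestrict K (hmemK t ht), by change _ ∈ T; exact ht, rfl⟩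
  -- A vector killed by `T*` is orthogonal to `K`.
  have hperp : ∀ v : L, (∀ t ∈ T, adjoint t v = 0) → ∀ k ∈ K, ⟪v, k⟫_ℂ = 0 := by
    intro v hv k hk
    have hle : K ≤ LinearMap.ker ((innerSL ℂ v : L →L[ℂ] ℂ) : L →ₗ[ℂ] ℂ) := by
      refine Submodule.topologicalClosure_minimal _ (iSup₂_le fun t ht => ?_)
        (ContinuousLinearMap.isClosed_ker (innerSL ℂ v))
      rintro _ ⟨h, rfl⟩
      change ⟪v, t h⟫_ℂ = 0
      rw [← ContinuousLinearMap.adjoint_inner_left, hv t ht, inner_zero_left]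
    exact hle hk
  have hnd : Nondegenerate T' := by
    refine ⟨fun h hh => eq_zero_of_one_mem_wstarSpan h1 fun t ht => ?_, fun k hk => ?_⟩
    · obtain ⟨t', ht', rfl⟩ := hlift t ht
      exact congrArg K.subtypeL (hh t' ht')
    · have : ⟪(k : L), (k : L)⟫_ℂ = 0 := hperp k (fun t ht => by
        obtain ⟨t', ht', rfl⟩ := hlift t ht
        rw [ContinuousLinearMap.adjoint_comp]
        change adjoint t' (adjoint K.subtypeL (k : L)) = 0
        rw [adjoint_subtypeL_coe, hk t' ht']) k k.2
      exact Subtype.ext (inner_self_eq_zero.1 this)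
  have hadj : ∀ s t : H →L[ℂ] K,
      adjoint (K.subtypeL ∘L s) ∘L (K.subtypeL ∘L t) = adjoint s ∘L t := by
    intro s t
    ext h
    rw [ContinuousLinearMap.adjoint_comp]
    exact congrArg (adjoint s) (adjoint_subtypeL_coe (t h))
  have hN : ∀ p ∈ N.carrier, ∀ s ∈ T', ∀ t ∈ T', Commute p (adjoint s ∘L t) := by
    intro p hp s hs t ht
    rw [← hadj]
    refine Nest.commute_of_mem_alg (hTA _ hs _ ht) ?_ hp
    rw [ContinuousLinearMap.adjoint_comp, ContinuousLinearMap.adjoint_adjoint]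
    exact hTA _ ht _ hs
  obtain ⟨θ, hθ⟩ := N.exists_starAlgEquiv hnd hN
  refine ⟨K, hK, N.transport hnd hN, θ, ?_, ?_⟩
  · ext q
    constructor
    · rintro ⟨p, hp, rfl⟩
      exact ⟨p, hp, hθ p⟩
    · rintro ⟨p, hp, hpq⟩
      refine ⟨⟨p, N.carrier_subset_doubleCommutant hp⟩, hp, ?_⟩
      exact Subtype.ext (Intertwines.right_unique hnd (hθ _) hpq)
  · rw [hYeq, image_opSpace]
    refine wstarSpan_mul_alg hT.ternary (fun p hp => ?_) (fun p hp t ht => ?_)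
      fun y hy v hv h => ?_
    · have := ((hθ p).isStarProjection hnd (N.isStarProjection _ hp)).isSelfAdjoint
      rw [ContinuousLinearMap.isSelfAdjoint_iff', adjoint_extendByZero, this.star_eq]
    · obtain ⟨t', ht', rfl⟩ := hlift t ht
      ext h
      change ((t' ((p : H →L[ℂ] H) h) : K) : L) =
        extendByZero (θ p : K →L[ℂ] K) ((t' h : K) : L)
      rw [extendByZero_coe, (hθ p t' ht').1]
    · have := hy 1 N.one_mem
      rw [map_one] at this
      have hyh : y h = ((adjoint K.subtypeL (y h) : K) : L) :=
        congrArg (fun z : H →L[ℂ] L => z h) this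
      rw [hyh]
      exact hperp v hv _ (Subtype.coe_prop _)

section Intertwiners

variable {N : Nest H} {K : Submodule ℂ L} [CompleteSpace K] {M : Nest K}
  (θ : N.doubleCommutant ≃⋆ₐ[ℂ] M.doubleCommutant)

/-- The operators `t : H → L` with range in `K` and `t x = θ(x) t` for all `x ∈ N''`. The condition
on the range is the one at `x = 1`. -/
def intertwinerSpace : Submodule ℂ (H →L[ℂ] L) where
  carrier := {t | ∀ x : N.doubleCommutant,
    t ∘L (x : H →L[ℂ] H) = extendByZero (θ x : K →L[ℂ] K) ∘L t}
  add_mem' hs ht x := by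
    rw [ContinuousLinearMap.add_comp, ContinuousLinearMap.comp_add, hs x, ht x]
  zero_mem' x := by simp
  smul_mem' c t ht x := by
    rw [ContinuousLinearMap.smul_comp, ContinuousLinearMap.comp_smul, ht x]

variable {θ}

theorem subtypeL_comp_mem_intertwinerSpace {t : H →L[ℂ] K}
    (ht : ∀ x : N.doubleCommutant, t ∘L (x : H →L[ℂ] H) = (θ x : K →L[ℂ] K) ∘L t) :
    K.subtypeL ∘L t ∈ intertwinerSpace θ := by
  intro x
  ext e
  change ((t ((x : H →L[ℂ] H) e) : K) : L) = extendByZero (θ x : K →L[ℂ] K) ((t e : K) : L)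
  rw [extendByZero_coe]
  exact congrArg (fun z : H →L[ℂ] K => ((z e : K) : L)) (ht x)

theorem adjoint_comp_extendByZero {t : H →L[ℂ] L} (ht : t ∈ intertwinerSpace θ)
    (x : N.doubleCommutant) :
    adjoint t ∘L extendByZero (θ x : K →L[ℂ] K) = (x : H →L[ℂ] H) ∘L adjoint t := by
  have h1 := congrArg adjoint (ht (star x))
  have h2 : adjoint ((star x : N.doubleCommutant) : H →L[ℂ] H) = x :=
    ContinuousLinearMap.adjoint_adjoint (x : H →L[ℂ] H)
  have h3 : star ((θ (star x) : M.doubleCommutant) : K →L[ℂ] K) = θ x := by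
    rw [map_star]
    exact star_star (θ x : K →L[ℂ] K)
  rw [ContinuousLinearMap.adjoint_comp, ContinuousLinearMap.adjoint_comp, adjoint_extendByZero,
    h2, h3] at h1
  exact h1.symm

variable (θ) in
theorem isWStarClosedTRO_intertwinerSpace : IsWStarClosedTRO (intertwinerSpace θ) := by
  constructor
  · have := isWStarClosed_forall_inner_eq (ι := N.doubleCommutant × H × L)
      (fun i => (i.1 : H →L[ℂ] H) i.2.1) (fun i => i.2.1) (fun i => i.2.2)
      (fun i => adjoint (extendByZero (θ i.1 : K →L[ℂ] K)) i.2.2)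
    convert this using 1
    ext t
    constructor
    · intro ht i
      rw [ContinuousLinearMap.adjoint_inner_left]
      exact congrArg (fun z : H →L[ℂ] L => ⟪i.2.2, z i.2.1⟫_ℂ) (ht i.1)
    · intro ht x
      ext h
      refine ext_inner_left ℂ fun k => ?_
      have := ht (x, h, k)
      rwa [ContinuousLinearMap.adjoint_inner_left] at this
  · intro r hr s hs t ht x
    rw [ContinuousLinearMap.comp_assoc, ContinuousLinearMap.comp_assoc, ht x,
      ← ContinuousLinearMap.comp_assoc (adjoint s), adjoint_comp_extendByZero hs x,
      ContinuousLinearMap.comp_assoc, ← ContinuousLinearMap.comp_assoc r, hr x,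
      ContinuousLinearMap.comp_assoc]

theorem eq_zero_of_forall_intertwinerSpace {h : H} (hh : ∀ t ∈ intertwinerSpace θ, t h = 0) :
    h = 0 :=
  eq_zero_of_intertwiners_eq_zero N.centralizer_centralizer_doubleCommutant
    M.centralizer_centralizer_doubleCommutant N.doubleCommutant_mul_comm θ fun _ ht =>
      Subtype.ext (hh _ (subtypeL_comp_mem_intertwinerSpace ht))

/-- The adjoints of the intertwiners of `θ⁻¹` intertwine `θ`, so they separate the vectors of
`K`. -/
theorem adjoint_subtypeL_eq_zero_of_forall_intertwinerSpace {v : L}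
    (hv : ∀ t ∈ intertwinerSpace θ, adjoint t v = 0) : adjoint K.subtypeL v = 0 := by
  refine eq_zero_of_intertwiners_eq_zero M.centralizer_centralizer_doubleCommutant
    N.centralizer_centralizer_doubleCommutant M.doubleCommutant_mul_comm θ.symm fun s hs => ?_
  have hmem : K.subtypeL ∘L adjoint s ∈ intertwinerSpace θ := by
    refine subtypeL_comp_mem_intertwinerSpace fun x => ?_
    have h1 := congrArg adjoint (hs (θ (star x)))
    have h2 : adjoint ((star x : N.doubleCommutant) : H →L[ℂ] H) = x :=
      ContinuousLinearMap.adjoint_adjoint (x : H →L[ℂ] H)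
    have h3 : adjoint ((θ (star x) : M.doubleCommutant) : K →L[ℂ] K) = θ x := by
      rw [map_star]
      exact ContinuousLinearMap.adjoint_adjoint (θ x : K →L[ℂ] K)
    rw [StarAlgEquiv.symm_apply_apply, ContinuousLinearMap.adjoint_comp,
      ContinuousLinearMap.adjoint_comp, h2, h3] at h1
    exact h1.symm
  have := hv _ hmem
  rwa [ContinuousLinearMap.adjoint_comp, ContinuousLinearMap.adjoint_adjoint] at this

/-- The module of a `*`-isomorphism `θ` is generated by the ternary ring of its intertwiners. -/
theorem isConcreteStronglyProjective_of_image_opSpace {Y : Submodule ℂ (H →L[ℂ] L)}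
    (hY : (Y : Set (H →L[ℂ] L)) = (fun y : H →L[ℂ] K => K.subtypeL ∘L y) '' opSpace θ) :
    IsConcreteStronglyProjective N.alg Y := by
  have hT := isWStarClosedTRO_intertwinerSpace θ
  have hsa : ∀ p : N.doubleCommutant, (p : H →L[ℂ] H) ∈ N.carrier →
      IsSelfAdjoint (extendByZero (θ p : K →L[ℂ] K)) := by
    intro p hp
    have hp' : star p = p := Subtype.ext (N.isStarProjection _ hp).isSelfAdjoint.star_eq
    have hθp : star (θ p : K →L[ℂ] K) = θ p := congrArg Subtype.val
      (show star (θ p) = θ p by rw [← map_star, hp'])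
    rw [ContinuousLinearMap.isSelfAdjoint_iff', adjoint_extendByZero, hθp]
  refine ⟨intertwinerSpace θ, hT, fun s hs t ht => Nest.mem_alg_of_commute fun p hp => ?_,
    one_mem_wstarSpan hT.ternary fun h hh => eq_zero_of_forall_intertwinerSpace hh, ?_⟩
  · have hp' := N.carrier_subset_doubleCommutant hp
    exact commute_adjoint_comp (N.isStarProjection p hp).isSelfAdjoint (hsa ⟨p, hp'⟩ hp)
      (ht ⟨p, hp'⟩) (hs ⟨p, hp'⟩)
  · rw [hY, image_opSpace]
    refine (wstarSpan_mul_alg hT.ternary hsa (fun p _ t ht => ht p) fun y hy v hv h => ?_).symm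
    have h1 := hy 1 N.one_mem
    rw [map_one] at h1
    have hyh : y h = K.subtypeL (adjoint K.subtypeL (y h)) :=
      congrArg (fun z : H →L[ℂ] L => z h) h1
    rw [hyh, ← ContinuousLinearMap.adjoint_inner_left,
      adjoint_subtypeL_eq_zero_of_forall_intertwinerSpace hv, inner_zero_left]

end Intertwiners

end Characterization

end NestModule

end

theorem corollary2 {H : Type*} [NormedAddCommGroup H] [InnerProductSpace ℂ H] [CompleteSpace H]
    {L : Type*} [NormedAddCommGroup L] [InnerProductSpace ℂ L] [CompleteSpace L]
    (N : NestModule.Nest H) (Y : Submodule ℂ (H →L[ℂ] L)) :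
    NestModule.IsConcreteStronglyProjective N.alg Y ↔
      ∃ (K : Submodule ℂ L) (_ : CompleteSpace K) (M : NestModule.Nest K)
        (θ : N.doubleCommutant ≃⋆ₐ[ℂ] M.doubleCommutant),
        θ '' {p : N.doubleCommutant | (p : H →L[ℂ] H) ∈ N.carrier} =
          {q : M.doubleCommutant | (q : K →L[ℂ] K) ∈ M.carrier} ∧
        (Y : Set (H →L[ℂ] L)) =
          (fun y : H →L[ℂ] K => K.subtypeL ∘L y) '' NestModule.opSpace θ := by
  refine ⟨NestModule.IsConcreteStronglyProjective.exists_nest, ?_⟩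
  rintro ⟨K, _, M, θ, -, hY⟩
  exact NestModule.isConcreteStronglyProjective_of_image_opSpace hY
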